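/- **Setting.** Let $(\Omega,\mathcal A,P)$ and $(\Omega',\mathcal A',P')$ be probability spaces. Let $Y=(y^i)_{i\in\mathbb Z}$ be an i.i.d. sequence on $\Omega$ with law $\mu$ on $\mathbb R^s$ (the environment), and let $(\varepsilon^i_t)_{i,t\in\mathbb Z}$ be real random variables on $\Omega'$ such that for each $i$ the sequence $\varepsilon^i=(\varepsilon^i_t)_{t}$ is i.i.d.; the $\varepsilon^i$ may depend on each other. For measurable maps $Z_t:\mathbb R^s\times\mathbb R^{\mathbb Z}\to\mathbb R$ put $Z^i_t(\omega,\omega')=Z_t(y^i(\omega),\varepsilon^i(\omega'))$. Write $\mathbb E^Y$, $\mathrm{cov}(\cdot,\cdot\mid Y)$ for expectation and covariance under $P'$ with $\omega$ fixed. Assume that the sequence $(Z^i)_{i\in\mathbb Z}$ of processes $Z^i=(Z^i_t)_{t\in\mathbb Z}$ is stationary in $i$ under $P\otimes P'$ and that, almost surely, $\mathbb E^Y[Z^i_t]=0$ for all $i,t$. Let $$X^N_t(Y)=\frac1{\sqrt N}\sum_{i=1}^N Z^i_t .$$ **Weak dependence.** For $f:\mathbb R^k\to\mathbb R$ let $\mathrm{Lip}(f)$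 be the least $L\ge 0$ with $|f(z)-f(z')|\le L\sum_m|z_m-z'_m|$. Let $V:\mathbb R^s\to[0,\infty)$ be measurable. $Z=(Z^i)$ is $(\kappa,Y)$-weakly dependent with control $V$ if, for almost every trajectory $Y$, $\mathbb E^{Y}[|Z^i_t|^2]\le V(y^i)^2$ for all $i,t$, and there is a sequence $\kappa(r)=\kappa(r,Y)$ decreasing to $0$ such that $$\Big|\mathrm{cov}\big(f(Z^{i_1}_{t_1},\dots,Z^{i_u}_{t_u}),\,g(Z^{j_1}_{t'_1},\dots,Z^{j_v}_{t'_v})\,\big|\,Y\big)\Big|\le \mathrm{Lip}(f)\,\mathrm{Lip}(g)\Big(\sum_{m=1}^uV(y^{i_m})\Big)\Big(\sum_{m=1}^vV(y^{j_m})\Big)\kappa(r)$$ for all $r,u,v\ge 0$, all indices $i_1\le\dots\le i_u\le i_u+r<j_1\le\dots\le j_v$ in $\mathbb Z$, all times $t_m,t'_m\in\mathbb Z$ such that the pairs $(i_m,t_m)$ are distinct and the pairs $(j_m,t'_m)$ are distinct, and all bounded Lipschitz $f:\mathbb R^u\to\mathbb R$ with $\|f\|_\infty\le1$ and bounded Lipschitz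 $g:\mathbb R^v\to\mathbb R$. **Theorem (CLT under $(\kappa,Y)$-weak dependence).** Let $Z$ be $(\kappa,Y)$-weakly dependent with control $V$, let $\delta>0$ and $\Gamma:\mathbb Z\to\mathbb R$, and assume: - (K$2_\delta$) $\mathbb E[|Z^i_t|^{2+\delta}]<\infty$ for all $i,t$; - (K4) for all $t,\tau\in\mathbb Z$, the conditional covariance $\Gamma^N(\tau,Y)=\mathrm{cov}(X^N_t(Y),X^N_{t+\tau}(Y)\mid Y)$ converges to $\Gamma(\tau)$ almost surely as $N\to\infty$; - (K5) $\mathbb E[V(y^0)]<\infty$; - for some $k>2+\frac2\delta$, almost surely $\kappa(r)=O(r^{-k})$ as $r\to\infty$. Then there is a centered Gaussian process $X=(X_t)_{t\in\mathbb Z}$ with covariance function $\mathrm{cov}(X_t,X_{t+\tau})=\Gamma(\tau)$ such that, for almost every trajectory $Y$, the process $X^N(Y)=(X^N_t(Y))_{t\in\mathbb Z}$ converges in distribution to $X$ in $\mathbb R^{\mathbb Z}$ (product topology) as $N\to\infty$. -/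

import Mathlib

open MeasureTheory ProbabilityTheory Filter Topology

namespace DoublyStochastic

/-- `L` is a Lipschitz constant of `f` with respect to the `ℓ¹`-distance on `ℝ^k`. -/
def IsLip {k : ℕ} (L : ℝ) (f : (Fin k → ℝ) → ℝ) : Prop :=
  0 ≤ L ∧ ∀ z z' : Fin k → ℝ, |f z - f z'| ≤ L * ∑ m, |z m - z' m|

/-- The Lipschitz constant `Lip(f)` with respect to the `ℓ¹`-distance (the least one). -/
noncomputable def lipConst {k : ℕ} (f : (Fin k → ℝ) → ℝ) : ℝ :=
  sInf {L : ℝ | IsLip L f}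

/-- The set `Δ^{(k)}` of bounded Lipschitz functions on `ℝ^k`. -/
def Delta (k : ℕ) : Set ((Fin k → ℝ) → ℝ) :=
  {f | (∃ C : ℝ, ∀ z, |f z| ≤ C) ∧ ∃ L : ℝ, IsLip L f}

/-- The set `Δ^{(k)}_1` of bounded Lipschitz functions on `ℝ^k` with supremum norm at most `1`. -/
def DeltaOne (k : ℕ) : Set ((Fin k → ℝ) → ℝ) :=
  {f | f ∈ Delta k ∧ ∀ z, |f z| ≤ 1}

/-- The data of a sequence of doubly stochastic processes `Z^i_t = Z_t(y^i, ε^i)` on the product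
of the environment space `(Ω, P)` and the innovation space `(Ω', P')`. The environment `Y = (y^i)`
is i.i.d. with law `μ` on `ℝ^s`, and for each `i` the innovations `(ε^i_t)_t` are i.i.d.;
no assumption is made on the dependence between the `ε^i` for different `i`. The environment is
independent of the innovations since they live on different factors. -/
structure Model (s : ℕ) {Ω Ω' : Type*} [MeasurableSpace Ω] [MeasurableSpace Ω']
    (P : Measure Ω) (P' : Measure Ω') (μ : Measure (EuclideanSpace ℝ (Fin s))) where
  /-- the random parameters `y^i` -/
  y : ℤ → Ω → EuclideanSpace ℝ (Fin s)
  /-- the innovations `ε^i_t`, as `ε i t` -/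
  ε : ℤ → ℤ → Ω' → ℝ
  /-- the maps `Z_t(y, ε)` of a parameter and an innovation sequence -/
  Z : ℤ → EuclideanSpace ℝ (Fin s) → (ℤ → ℝ) → ℝ
  measurable_y : ∀ i, Measurable (y i)
  measurable_ε : ∀ i t, Measurable (ε i t)
  measurable_Z : ∀ t, Measurable (fun q : EuclideanSpace ℝ (Fin s) × (ℤ → ℝ) => Z t q.1 q.2)
  law_y : ∀ i, P.map (y i) = μ
  indep_y : iIndepFun y P
  indep_ε : ∀ i, iIndepFun (ε i) P'
  identDistrib_ε : ∀ i t t', IdentDistrib (ε i t) (ε i t') P' P'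

namespace Model

variable {s : ℕ} {Ω Ω' : Type*} [MeasurableSpace Ω] [MeasurableSpace Ω']
  {P : Measure Ω} {P' : Measure Ω'} {μ : Measure (EuclideanSpace ℝ (Fin s))}

/-- The elementary process `Z^i_t(ω, ω') = Z_t(y^i(ω), ε^i(ω'))`. Integrals over `ω'` with `ω`
fixed are the conditional expectations `𝔼^Y` given the environment. -/
def elem (M : Model s P P' μ) (i t : ℤ) (ω : Ω) (ω' : Ω') : ℝ :=
  M.Z t (M.y i ω) (fun k => M.ε i k ω')

/-- The partial aggregation `X^N_t(Y) = N^{-1/2} ∑_{i=1}^N Z^i_t`. -/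
noncomputable def agg (M : Model s P P' μ) (N : ℕ) (t : ℤ) (ω : Ω) (ω' : Ω') : ℝ :=
  (Real.sqrt N)⁻¹ * ∑ i ∈ Finset.Icc 1 N, M.elem (i : ℤ) t ω ω'

/-- The covariance, given the environment, of `X^N_t(Y)` and `X^N_{t+τ}(Y)`. -/
noncomputable def aggCov (M : Model s P P' μ) (N : ℕ) (t τ : ℤ) (ω : Ω) : ℝ :=
  covariance (M.agg N t ω) (M.agg N (t + τ) ω) P'

/-- The sequence `(Z^i)_{i ∈ ℤ}` of processes `Z^i = (Z^i_t)_{t ∈ ℤ}` is stationary in `i`. -/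
def IsStationary (M : Model s P P' μ) : Prop :=
  (P.prod P').map (fun (p : Ω × Ω') (q : ℤ × ℤ) => M.elem (q.1 + 1) q.2 p.1 p.2) =
    (P.prod P').map (fun (p : Ω × Ω') (q : ℤ × ℤ) => M.elem q.1 q.2 p.1 p.2)

/-- The processes are centered given the environment: `𝔼^Y[Z^i_t] = 0` almost surely. -/
def IsCentered (M : Model s P P' μ) : Prop :=
  ∀ᵐ ω ∂P, ∀ i t, ∫ ω', M.elem i t ω ω' ∂P' = 0

/-- `(κ, ψ, Y)`-weak dependence of `(Z^i)`, with control function `V`. The coefficients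
`κ ω r` may depend on the environment. In each of the two groups, the arguments are the variables
`Z^i_t` at distinct pairs `(i, t)`; the indices `i` are in nondecreasing order, so that
several times `t` may occur with the same index `i`. -/
def IsWeaklyDependent (M : Model s P P' μ) (ψ : ℝ → ℝ → ℝ → ℝ → ℝ)
    (V : EuclideanSpace ℝ (Fin s) → ℝ) (κ : Ω → ℕ → ℝ) : Prop :=
  Measurable V ∧ (∀ x, 0 ≤ V x) ∧
  (∀ᵐ ω ∂P, ∀ i t, ∫⁻ ω', ENNReal.ofReal ((M.elem i t ω ω') ^ 2) ∂P' ≤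
    ENNReal.ofReal ((V (M.y i ω)) ^ 2)) ∧
  ∀ᵐ ω ∂P, Antitone (κ ω) ∧ Tendsto (κ ω) atTop (𝓝 0) ∧
    ∀ (r u v : ℕ) (i t : Fin u → ℤ) (j t' : Fin v → ℤ),
      Monotone i → Monotone j →
      Function.Injective (fun m => (i m, t m)) → Function.Injective (fun m => (j m, t' m)) →
      (∀ m n, i m + (r : ℤ) < j n) →
      ∀ f ∈ DeltaOne u, ∀ g ∈ Delta v,
        |covariance (fun ω' => f (fun m => M.elem (i m) (t m) ω ω'))
            (fun ω' => g (fun m => M.elem (j m) (t' m) ω ω')) P'| ≤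
          ψ (∑ m, V (M.y (i m) ω)) (∑ m, V (M.y (j m) ω)) (lipConst f) (lipConst g) * κ ω r

/-- `(κ, Y)`-weak dependence: the case `ψ(u, v, a, b) = a b u v`. -/
def IsKappaWeaklyDependent (M : Model s P P' μ) (V : EuclideanSpace ℝ (Fin s) → ℝ)
    (κ : Ω → ℕ → ℝ) : Prop :=
  M.IsWeaklyDependent (fun u v a b => a * b * u * v) V κ

end Model

/-- `G` is the law on `ℝ^ℤ` of a centered Gaussian process with covariance function `Γ`. -/
def IsCenteredGaussianLaw (G : Measure (ℤ → ℝ)) (Γ : ℤ → ℝ) : Prop :=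
  IsGaussianProcess (fun (t : ℤ) (x : ℤ → ℝ) => x t) G ∧
  (∀ t, ∫ x, x t ∂G = 0) ∧
  ∀ t τ, covariance (fun x : ℤ → ℝ => x t) (fun x : ℤ → ℝ => x (t + τ)) G = Γ τ

end DoublyStochastic

/-!
The environment `ω` is fixed outside a null set, and what remains is a central limit theorem for
the array `Z^i_t(ω, ·)`, which need not be stationary or strongly mixing but satisfies
the covariance inequality with controls `V(y^i)`.

*Fixed environment.* Let `ξ_i = ∑_t a_t Z^i_t` be a finite linear combination over times. Weak
dependence tested on cosines and sines makes the characteristic functions of sums of `ξ_i` over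
separated index sets factorize up to `κ(r)` (`IsQuenchedDependent.norm_expI_sub_mul_le`). Tested
on truncations at level `R`, it bounds the covariances of the `ξ_i` themselves: the truncated
variables are rescaled by `1 / R` to meet the sup-norm condition, and `R²` cancels on both sides
of the inequality (`IsQuenchedDependent.abs_cov_sum_le`). Bernstein's method then applies
(`norm_expI_sum_sub_exp_variance_le`): the index range is cut into large blocks separated by gaps,
the large blocks are decoupled, and each of them is compared with a Gaussian variable by Lyapunov's
bound. Among the possible positions of the gaps one is selected by averaging for which the gaps
carry a vanishing share of the covariance (`exists_gap_le`); no uniform bound on the variances of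
the single `ξ_i` is available.

*Exponents.* If sums over `i ≤ N` of controls and moments grow at most like `N^{1+ε}` for every
`ε > 0`, then gaps of length `N^β` decouple the blocks when `kβ > 1`, and Lyapunov's condition
holds for large blocks of length slightly above `N^β` when `(1 + δ) β < δ / 2`. Such a `β` exists
exactly when `k > 2 (1 + δ) / δ = 2 + 2 / δ`, which is the assumption on the decay of `κ`
(`tendsto_expI_of_decoupling`).

*Growth.* The bounds `N^{1+ε}` hold almost surely for the conditional moments of order `2 + δ`, for
`V(y^i)`, and for the pair sums of `V(y^i) V(y^j) |i - j|^{-k}`, because `∑_i F_i / i^{1+ε}` has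
finite expectation whenever the `F_i ≥ 0` have bounded expectations (`ae_exists_sum_le_rpow`). No
law of large numbers is needed; stationarity bounds the expected moments, and independence of
`y^i` and `y^j` those of the products. The loss `N^ε` is absorbed by the strict inequality for `k`.

*Limit law.* The convergence of the conditional covariances identifies the limits of the
finite-dimensional characteristic functions and bounds the variances of `X^N_t`, so the laws of
`X^N(Y)` on `ℝ^ℤ` are tight. By Prokhorov's theorem the limits are the characteristic functions of
a probability law, and convergence to it is weak convergence
(`exists_finCharFun_eq_of_tight`, `tendsto_of_tight_of_finCharFun`). The limits do not depend on the
environment, hence neither does the law.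
-/

/-! ### Weak convergence of laws on a countable product of lines -/

namespace DoublyStochastic

open scoped ENNReal NNReal

/-- The characteristic function of the law `G` on `ℝ^ι`, evaluated at the finitely supported
linear form `x ↦ ∑_{t ∈ T} a_t x_t`. -/
noncomputable def finCharFun {ι : Type*} (G : Measure (ι → ℝ)) (T : Finset ι) (a : ι → ℝ) : ℂ :=
  ∫ x, Complex.exp ((∑ t ∈ T, a t * x t : ℝ) * Complex.I) ∂G

/-- Chebyshev's inequality in each coordinate confines the mass, up to `ε`, to a product of
compact intervals. -/
lemma isTightMeasureSet_of_lintegral_sq_le {ι : Type*} [Countable ι] {S : Set (Measure (ι → ℝ))}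
    (C : ι → ℝ≥0) (hS : ∀ μ ∈ S, ∀ t, ∫⁻ x, ENNReal.ofReal (x t ^ 2) ∂μ ≤ C t) :
    IsTightMeasureSet S := by
  rw [isTightMeasureSet_iff_exists_isCompact_measure_compl_le]
  intro ε hε
  obtain ⟨e, he, hsum⟩ := ENNReal.exists_pos_sum_of_countable hε.ne' ι
  set R : ι → ℝ := fun t => 1 + C t / e t with hR
  refine ⟨Set.pi Set.univ fun t => Set.Icc (-R t) (R t),
    isCompact_univ_pi fun t => isCompact_Icc, fun μ hμ => ?_⟩
  have hsub : (Set.pi Set.univ fun t => Set.Icc (-R t) (R t))ᶜ ⊆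
      ⋃ t, {x : ι → ℝ | ENNReal.ofReal (R t ^ 2) ≤ ENNReal.ofReal (x t ^ 2)} := by
    intro x hx
    simp only [Set.mem_compl_iff, Set.mem_pi, Set.mem_univ, true_imp_iff, not_forall] at hx
    obtain ⟨t, ht⟩ := hx
    refine Set.mem_iUnion.2 ⟨t, ENNReal.ofReal_le_ofReal ?_⟩
    have h1 : 0 ≤ R t := by positivity
    rw [Set.mem_Icc, ← abs_le, not_le] at ht
    rw [← sq_abs (x t)]
    gcongr
  calc μ _ ≤ μ (⋃ t, {x : ι → ℝ | ENNReal.ofReal (R t ^ 2) ≤ ENNReal.ofReal (x t ^ 2)}) :=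
        measure_mono hsub
    _ ≤ ∑' t, μ {x : ι → ℝ | ENNReal.ofReal (R t ^ 2) ≤ ENNReal.ofReal (x t ^ 2)} :=
        measure_iUnion_le _
    _ ≤ ∑' t, (e t : ℝ≥0∞) := by
        refine ENNReal.tsum_le_tsum fun t => ?_
        have h1 : 1 ≤ R t := by
          have : (0 : ℝ) ≤ C t / e t := by positivity
          simp only [hR]; linarith
        have h2 : (0 : ℝ) < R t ^ 2 := by positivity
        have hm : AEMeasurable (fun x : ι → ℝ => ENNReal.ofReal (x t ^ 2)) μ :=
          (Measurable.ennreal_ofReal (by fun_prop)).aemeasurable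
        refine (meas_ge_le_lintegral_div hm (ENNReal.ofReal_pos.2 h2).ne'
          ENNReal.ofReal_ne_top).trans ?_
        refine ENNReal.div_le_of_le_mul ((hS μ hμ t).trans ?_)
        have h3 : (C t : ℝ) ≤ e t * R t ^ 2 := by
          have he' : (0 : ℝ) < e t := he t
          have : (C t : ℝ) = e t * (C t / e t) := by field_simp
          rw [this]
          gcongr
          calc (C t / e t : ℝ) ≤ R t := by simp [hR]
            _ ≤ R t ^ 2 := by nlinarith
        rw [← ENNReal.ofReal_coe_nnreal, ← ENNReal.ofReal_coe_nnreal (p := e t),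
          ← ENNReal.ofReal_mul (by positivity)]
        exact ENNReal.ofReal_le_ofReal h3
    _ ≤ ε := hsum.le

/-- A linear form on `ℝ^T`, composed with restriction to `T`, written in coordinates. -/
lemma dual_restrict_apply {ι : Type*} [DecidableEq ι] {T : Finset ι}
    (L : StrongDual ℝ (T → ℝ)) (x : ι → ℝ) :
    L (T.restrict x) =
      ∑ t ∈ T, (if ht : t ∈ T then L (Pi.single ⟨t, ht⟩ 1) else 0) * x t := by
  rw [← Finset.sum_coe_sort]
  conv_lhs => rw [← ContinuousLinearMap.coe_coe, LinearMap.pi_apply_eq_sum_univ]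
  refine Finset.sum_congr rfl fun t _ => ?_
  have h1 : (fun j : T => if t = j then (1 : ℝ) else 0) = Pi.single t 1 := by
    ext i
    simp [Pi.single_apply, eq_comm]
  simp only [Finset.restrict, smul_eq_mul, h1, ContinuousLinearMap.coe_coe, dif_pos t.2]
  rw [mul_comm]

/-- Finite measures on `ℝ^ι` are determined by the characteristic functions of their
finite-dimensional marginals. -/
lemma measure_ext_of_finCharFun {ι : Type*} {μ ν : Measure (ι → ℝ)} [IsFiniteMeasure μ]
    [IsFiniteMeasure ν] (h : ∀ T a, finCharFun μ T a = finCharFun ν T a) : μ = ν := by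
  classical
  have key : ∀ T : Finset ι, μ.map T.restrict = ν.map T.restrict := by
    intro T
    refine Measure.ext_of_charFunDual ?_
    ext L
    have hL := dual_restrict_apply L
    have hm : ∀ ρ : Measure (ι → ℝ), charFunDual (ρ.map T.restrict) L = finCharFun ρ T
        (fun t => if ht : t ∈ T then L (Pi.single ⟨t, ht⟩ 1) else 0) := by
      intro ρ
      rw [charFunDual_apply, integral_map (Finset.measurable_restrict T).aemeasurable
        (by fun_prop), finCharFun]
      simp_rw [hL]
    rw [hm, hm, h]
  have hf : ∀ T : Finset ι, IsFiniteMeasure (ν.map T.restrict) := fun T => inferInstance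
  exact IsProjectiveLimit.unique (P := fun T : Finset ι => ν.map T.restrict) key fun T => rfl

lemma continuous_finCharFun {ι : Type*} [Countable ι] (T : Finset ι) (a : ι → ℝ) :
    Continuous fun μ : ProbabilityMeasure (ι → ℝ) => finCharFun (μ : Measure (ι → ℝ)) T a := by
  let g : BoundedContinuousFunction (ι → ℝ) ℂ := BoundedContinuousFunction.ofNormedAddCommGroup
    (fun x => Complex.exp ((∑ t ∈ T, a t * x t : ℝ) * Complex.I)) (by fun_prop) 1
    (fun x => (Complex.norm_exp_ofReal_mul_I _).le)
  rw [continuous_iff_continuousAt]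
  intro μ
  exact (ProbabilityMeasure.tendsto_iff_forall_integral_rclike_tendsto ℂ).1 tendsto_id g

/-- By Prokhorov's theorem, a tight sequence whose finite-dimensional characteristic functions
converge has a cluster point realising the limits. -/
lemma exists_finCharFun_eq_of_tight {ι : Type*} [Countable ι] {μ : ℕ → ProbabilityMeasure (ι → ℝ)}
    (ht : IsTightMeasureSet {(μ n : Measure (ι → ℝ)) | n}) {φ : Finset ι → (ι → ℝ) → ℂ}
    (h : ∀ T a, Tendsto (fun n => finCharFun (μ n : Measure (ι → ℝ)) T a) atTop (𝓝 (φ T a))) :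
    ∃ G : ProbabilityMeasure (ι → ℝ), ∀ T a, finCharFun (G : Measure (ι → ℝ)) T a = φ T a := by
  have hc : IsCompact (closure {μ n | n}) :=
    isCompact_closure_of_isTightMeasureSet (by simpa using ht)
  obtain ⟨G, -, hG⟩ := hc.ultrafilter_le_nhds ((Ultrafilter.of atTop).map μ)
    (le_principal_iff.2 (Filter.mem_map.2 (Filter.univ_mem' fun n => subset_closure ⟨n, rfl⟩)))
  have hle : (Ultrafilter.of (atTop : Filter ℕ) : Filter ℕ) ≤ atTop := Ultrafilter.of_le _
  refine ⟨G, fun T a => tendsto_nhds_unique (f := fun n => finCharFun (μ n : Measure (ι → ℝ)) T a)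
    ?_ ((h T a).mono_left hle)⟩
  exact ((continuous_finCharFun T a).tendsto G).comp (show Tendsto μ _ _ from hG)

/-- Convergence of the finite-dimensional characteristic functions of a tight sequence is weak
convergence. -/
lemma tendsto_of_tight_of_finCharFun {ι : Type*} [Countable ι]
    {μ : ℕ → ProbabilityMeasure (ι → ℝ)} {G : ProbabilityMeasure (ι → ℝ)}
    (ht : IsTightMeasureSet {(μ n : Measure (ι → ℝ)) | n})
    (h : ∀ T a, Tendsto (fun n => finCharFun (μ n : Measure (ι → ℝ)) T a) atTop
      (𝓝 (finCharFun (G : Measure (ι → ℝ)) T a))) :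
    Tendsto μ atTop (𝓝 G) := by
  refine (Filter.tendsto_iff_ultrafilter _ _ _).2 fun U hU => ?_
  have hc : IsCompact (closure {μ n | n}) :=
    isCompact_closure_of_isTightMeasureSet (by simpa using ht)
  obtain ⟨G', -, hG'⟩ := hc.ultrafilter_le_nhds (U.map μ)
    (le_principal_iff.2 (Filter.mem_map.2 (Filter.univ_mem' fun n => subset_closure ⟨n, rfl⟩)))
  have hG' : Tendsto μ U (𝓝 G') := hG'
  -- Every limit point along an ultrafilter has the characteristic functions of `G`.
  suffices G' = G by rwa [← this]
  refine Subtype.ext (measure_ext_of_finCharFun (μ := (G' : Measure (ι → ℝ)))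
    (ν := (G : Measure (ι → ℝ))) fun T a => ?_)
  exact tendsto_nhds_unique (((continuous_finCharFun T a).tendsto G').comp hG')
    ((h T a).comp hU)

/-- A law on `ℝ^ℤ` is centered Gaussian with covariance function `Γ` as soon as its
finite-dimensional characteristic functions are the Gaussian ones. -/
lemma isCenteredGaussianLaw_of_finCharFun {G : Measure (ℤ → ℝ)} [IsProbabilityMeasure G]
    {Γ : ℤ → ℝ} (hΓ : ∀ τ, Γ (-τ) = Γ τ)
    (hpos : ∀ (T : Finset ℤ) (a : ℤ → ℝ), 0 ≤ ∑ t ∈ T, ∑ u ∈ T, a t * a u * Γ (u - t))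
    (h : ∀ T a, finCharFun G T a =
      Complex.exp (-((∑ t ∈ T, ∑ u ∈ T, a t * a u * Γ (u - t) : ℝ) / 2 : ℂ))) :
    IsCenteredGaussianLaw G Γ := by
  classical
  set q : Finset ℤ → (ℤ → ℝ) → ℝ := fun T a => ∑ t ∈ T, ∑ u ∈ T, a t * a u * Γ (u - t) with hq
  have hlaw : ∀ T a, G.map (fun x : ℤ → ℝ => ∑ t ∈ T, a t * x t) =
      gaussianReal 0 (q T a).toNNReal := by
    intro T a
    have hm : Measurable (fun x : ℤ → ℝ => ∑ t ∈ T, a t * x t) := by fun_prop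
    have := Measure.isProbabilityMeasure_map (μ := G) hm.aemeasurable
    refine Measure.ext_of_charFun ?_
    ext r
    rw [charFun_gaussianReal, charFun_apply_real, integral_map hm.aemeasurable (by fun_prop)]
    have h1 := h T (fun t => r * a t)
    rw [finCharFun] at h1
    have h2 : (∑ t ∈ T, ∑ u ∈ T, r * a t * (r * a u) * Γ (u - t)) = r ^ 2 * q T a := by
      simp only [hq, Finset.mul_sum]
      refine Finset.sum_congr rfl fun t _ => Finset.sum_congr rfl fun u _ => by ring
    rw [h2] at h1
    have h3 : ((q T a).toNNReal : ℝ) = q T a := Real.coe_toNNReal _ (hpos T a)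
    have h4 : (((q T a).toNNReal : ℝ≥0) : ℂ) = (q T a : ℂ) := by exact_mod_cast h3
    convert! h1 using 1
    · refine integral_congr_ae (Eventually.of_forall fun x => ?_)
      simp only [Finset.mul_sum, Complex.ofReal_sum, Complex.ofReal_mul, mul_assoc]
    · rw [h4]
      congr 1
      push_cast
      ring
  have hmean : ∀ (T : Finset ℤ) (a : ℤ → ℝ), ∫ x : ℤ → ℝ, (∑ t ∈ T, a t * x t) ∂G = 0 := by
    intro T a
    have hm : Measurable (fun x : ℤ → ℝ => ∑ t ∈ T, a t * x t) := by fun_prop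
    have := integral_map (μ := G) hm.aemeasurable (f := fun y : ℝ => y) (by fun_prop)
    rw [← this, hlaw, integral_id_gaussianReal]
  have hvar : ∀ (T : Finset ℤ) (a : ℤ → ℝ),
      Var[fun x : ℤ → ℝ => ∑ t ∈ T, a t * x t; G] = q T a := by
    intro T a
    have hm : Measurable (fun x : ℤ → ℝ => ∑ t ∈ T, a t * x t) := by fun_prop
    rw [← variance_id_map hm.aemeasurable, hlaw, variance_id_gaussianReal,
      Real.coe_toNNReal _ (hpos T a)]
  have hL2 : ∀ t, MemLp (fun x : ℤ → ℝ => x t) 2 G := by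
    intro t
    have h1 := hlaw {t} 1
    simp only [Finset.sum_singleton, Pi.one_apply, one_mul] at h1
    have h2 : MemLp id 2 (G.map fun x : ℤ → ℝ => x t) := by
      rw [h1]; exact memLp_id_gaussianReal 2
    exact h2.comp_of_map (measurable_pi_apply t).aemeasurable
  refine ⟨⟨fun I => ⟨⟨fun L => ?_⟩⟩⟩, fun t => ?_, fun t τ => ?_⟩
  · have hL := dual_restrict_apply L
    set a : ℤ → ℝ := fun t => if ht : t ∈ I then L (Pi.single ⟨t, ht⟩ 1) else 0
    have hr : Measurable fun x : ℤ → ℝ => I.restrict x := Finset.measurable_restrict I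
    have hLm : Measurable L := L.continuous.measurable
    have e1 : (G.map fun x : ℤ → ℝ => I.restrict fun t => x t).map L =
        gaussianReal 0 (q I a).toNNReal := by
      rw [← hlaw, Measure.map_map hLm hr]
      congr 1
      ext x
      exact hL x
    rw [e1]
    congr 1
    · rw [integral_map hr.aemeasurable (by fun_prop)]
      simp_rw [hL]
      exact (hmean I a).symm
    · rw [variance_map hLm.aemeasurable hr.aemeasurable]
      congr 1
      rw [← hvar I a]
      congr 1
      ext x
      exact (hL x).symm
  · simpa using hmean {t} 1
  · have e2 : ∀ t, Var[fun x : ℤ → ℝ => x t; G] = Γ 0 := by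
      intro t
      simpa [hq] using hvar {t} 1
    rcases eq_or_ne τ 0 with rfl | hτ
    · rw [add_zero, covariance_self (measurable_pi_apply t).aemeasurable, e2]
    -- The covariance is read off from the variance of the sum of the two coordinates.
    · have hne : t ≠ t + τ := by simpa using hτ
      have h1 := hvar {t, t + τ} 1
      have h2 := variance_fun_add (hL2 t) (hL2 (t + τ))
      simp only [Finset.sum_pair hne, Pi.one_apply, one_mul, hq] at h1
      rw [h1, e2, e2] at h2
      have h3 := hΓ τ
      have h4 : t - (t + τ) = -τ := by ring
      simp only [sub_self, add_sub_cancel_left, h4, h3] at h2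
      linarith

end DoublyStochastic

/-! ### Second-order expansion of characteristic functions -/

namespace DoublyStochastic

/-- The characteristic function of the random variable `U` at `1`, i.e. `𝔼 e^{iU}`. -/
noncomputable def expI {Ω : Type*} [MeasurableSpace Ω] (P : Measure Ω) (U : Ω → ℝ) : ℂ :=
  ∫ ω, Complex.exp (U ω * Complex.I) ∂P

lemma norm_expI_le_one {Ω : Type*} [MeasurableSpace Ω] (P : Measure Ω) [IsProbabilityMeasure P]
    (U : Ω → ℝ) : ‖expI P U‖ ≤ 1 := by
  refine (norm_integral_le_integral_norm _).trans ?_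
  simp [Complex.norm_exp_ofReal_mul_I]

lemma integrable_exp_mul_I {Ω : Type*} [MeasurableSpace Ω] {P : Measure Ω}
    [IsFiniteMeasure P] {U : Ω → ℝ} (hU : AEStronglyMeasurable U P) :
    Integrable (fun ω => Complex.exp (U ω * Complex.I)) P := by
  refine Integrable.of_bound (C := 1) ?_ (Eventually.of_forall fun ω => ?_)
  · exact Complex.continuous_exp.comp_aestronglyMeasurable
      ((Complex.continuous_ofReal.comp_aestronglyMeasurable hU).mul_const _)
  · exact (Complex.norm_exp_ofReal_mul_I _).le

/-- Taylor remainder at order two, interpolated between the orders `2` and `3`: below the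
threshold `η` the cubic bound is used, above it the quadratic one. -/
lemma norm_exp_sub_taylor_le {δ η : ℝ} (hδ : 0 < δ) (hη : 0 < η) (hη1 : η ≤ 1) (x : ℝ) :
    ‖Complex.exp (x * Complex.I) - (1 + x * Complex.I - (x : ℂ) ^ 2 / 2)‖ ≤
      η * x ^ 2 + 4 * η ^ (-δ) * |x| ^ (2 + δ) := by
  have hpow : η < |x| → x ^ 2 ≤ η ^ (-δ) * |x| ^ (2 + δ) := by
    intro h
    have hx : 0 < |x| := hη.trans h
    have h1 : 1 ≤ η ^ (-δ) * |x| ^ δ := by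
      rw [Real.rpow_neg hη.le, inv_mul_eq_div, one_le_div (Real.rpow_pos_of_pos hη _)]
      exact Real.rpow_le_rpow hη.le h.le hδ.le
    rw [Real.rpow_add hx, Real.rpow_two, sq_abs]
    nlinarith [sq_nonneg x]
  have h0 : 0 ≤ η ^ (-δ) * |x| ^ (2 + δ) := by positivity
  rcases le_or_gt |x| 1 with h | h
  · have hb : ‖Complex.exp (x * Complex.I) - (1 + x * Complex.I - (x : ℂ) ^ 2 / 2)‖ ≤ |x| ^ 3 := by
      have hn : ‖(x : ℂ) * Complex.I‖ = |x| := by simp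
      have := Complex.exp_bound (x := x * Complex.I) (hn.trans_le h) (n := 3) (by norm_num)
      rw [hn] at this
      have e : (1 + x * Complex.I - (x : ℂ) ^ 2 / 2) =
          ∑ m ∈ Finset.range 3, (x * Complex.I) ^ m / (m.factorial : ℂ) := by
        simp [Finset.sum_range_succ, Nat.factorial, mul_pow, Complex.I_sq]
        ring
      rw [e]
      refine this.trans ?_
      have : (0 : ℝ) ≤ |x| ^ 3 := by positivity
      norm_num [Nat.factorial]
      linarith
    refine hb.trans ?_
    rcases le_or_gt |x| η with h' | h'
    · have : |x| ^ 3 ≤ η * x ^ 2 := by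
        rw [← sq_abs x, pow_succ, mul_comm]
        gcongr
      linarith
    · have h2 : |x| ^ 3 ≤ x ^ 2 := by
        rw [← sq_abs x, pow_succ]
        exact mul_le_of_le_one_right (by positivity) h
      have := hpow h'
      have : 0 ≤ η * x ^ 2 := by positivity
      linarith
  · have hb : ‖Complex.exp (x * Complex.I) - (1 + x * Complex.I - (x : ℂ) ^ 2 / 2)‖ ≤
        2 + |x| + x ^ 2 / 2 := by
      calc _ ≤ ‖Complex.exp (x * Complex.I)‖ + ‖(1 + x * Complex.I - (x : ℂ) ^ 2 / 2)‖ :=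
            norm_sub_le _ _
        _ ≤ 1 + (‖(1 : ℂ)‖ + ‖x * Complex.I‖ + ‖(x : ℂ) ^ 2 / 2‖) := by
            gcongr
            · exact (Complex.norm_exp_ofReal_mul_I _).le
            · exact (norm_sub_le _ _).trans (by gcongr; exact norm_add_le _ _)
        _ = 2 + |x| + x ^ 2 / 2 := by
            simp
            ring
    have h2 : 2 + |x| + x ^ 2 / 2 ≤ 4 * x ^ 2 := by
      rw [← sq_abs x]
      nlinarith
    have := hpow (hη1.trans_lt h)
    have : 0 ≤ η * x ^ 2 := by positivity
    linarith

lemma abs_exp_neg_sub_le {y : ℝ} (hy : 0 ≤ y) : |Real.exp (-y) - (1 - y)| ≤ y ^ 2 := by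
  rcases le_or_gt y 1 with h | h
  · have := Real.abs_exp_sub_one_sub_id_le (x := -y) (by rwa [abs_neg, abs_of_nonneg hy])
    rw [neg_sq] at this
    convert this using 2
    ring
  · have h1 := Real.one_sub_le_exp_neg y
    have h2 : Real.exp (-y) ≤ 1 := Real.exp_le_one_iff.2 (by linarith)
    rw [abs_of_nonneg (by linarith)]
    nlinarith

/-- The characteristic function of a centered variable against that of the Gaussian with the
same variance, with Lyapunov's error term. -/
lemma norm_expI_sub_exp_le {Ω : Type*} [MeasurableSpace Ω] {P : Measure Ω}
    [IsProbabilityMeasure P] {U : Ω → ℝ} {δ η : ℝ} (hδ : 0 < δ) (hη : 0 < η) (hη1 : η ≤ 1)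
    (hU : MemLp U 2 P) (h0 : ∫ ω, U ω ∂P = 0)
    (hU' : Integrable (fun ω => |U ω| ^ (2 + δ)) P) :
    ‖expI P U - Complex.exp (-(Var[U; P] / 2 : ℝ))‖ ≤
      η * Var[U; P] + 4 * η ^ (-δ) * ∫ ω, |U ω| ^ (2 + δ) ∂P +
        (η ^ 2 + η ^ (-δ) * ∫ ω, |U ω| ^ (2 + δ) ∂P) * Var[U; P] := by
  set v := Var[U; P] with hv
  set M := ∫ ω, |U ω| ^ (2 + δ) ∂P with hM
  have hsq : Integrable (fun ω => U ω ^ 2) P := hU.integrable_sq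
  have hint : Integrable U P := hU.integrable one_le_two
  have hvar : v = ∫ ω, U ω ^ 2 ∂P :=
    variance_of_integral_eq_zero hU.aestronglyMeasurable.aemeasurable h0
  have hv0 : 0 ≤ v := variance_nonneg _ _
  have hM0 : 0 ≤ M := integral_nonneg fun ω => by positivity
  -- This bound on one factor `v` tames the error `v²` of `e^{-v/2} ≈ 1 - v/2`.
  have hvb : v ≤ η ^ 2 + η ^ (-δ) * M := by
    rw [hvar, hM, ← integral_const_mul]
    calc ∫ ω, U ω ^ 2 ∂P ≤ ∫ ω, (η ^ 2 + η ^ (-δ) * |U ω| ^ (2 + δ)) ∂P := by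
          refine integral_mono hsq ((integrable_const _).add (hU'.const_mul _)) fun ω => ?_
          dsimp only
          have h1 : 0 ≤ η ^ (-δ) * |U ω| ^ (2 + δ) := by positivity
          rcases le_or_gt |U ω| η with h | h
          · have : U ω ^ 2 ≤ η ^ 2 := by rw [← sq_abs]; gcongr
            linarith
          · have hx : 0 < |U ω| := hη.trans h
            have h2 : 1 ≤ η ^ (-δ) * |U ω| ^ δ := by
              rw [Real.rpow_neg hη.le, inv_mul_eq_div, one_le_div (Real.rpow_pos_of_pos hη _)]
              exact Real.rpow_le_rpow hη.le h.le hδ.le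
            rw [Real.rpow_add hx, Real.rpow_two, sq_abs]
            nlinarith [sq_nonneg (U ω), sq_nonneg η]
      _ = _ := by
          rw [integral_add (integrable_const _) (hU'.const_mul _)]
          simp
  have h1 : ‖expI P U - (1 - v / 2 : ℝ)‖ ≤ η * v + 4 * η ^ (-δ) * M := by
    have e : ((1 - v / 2 : ℝ) : ℂ) =
        ∫ ω, (1 + U ω * Complex.I - (U ω : ℂ) ^ 2 / 2) ∂P := by
      have i1 : Integrable (fun ω => (U ω : ℂ) * Complex.I) P := hint.ofReal.mul_const _
      have i2 : Integrable (fun ω => (U ω : ℂ) ^ 2 / 2) P := by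
        have := hsq.ofReal (𝕜 := ℂ)
        simp only [Complex.coe_algebraMap, Complex.ofReal_pow] at this
        exact this.div_const _
      have i0 : Integrable (fun ω => (1 : ℂ) + U ω * Complex.I) P := (integrable_const _).add i1
      rw [integral_sub i0 i2, integral_add (integrable_const _) i1, integral_mul_const,
        integral_div, integral_complex_ofReal, h0]
      have : ∫ ω, (U ω : ℂ) ^ 2 ∂P = ((∫ ω, U ω ^ 2 ∂P : ℝ) : ℂ) := by
        rw [← integral_complex_ofReal]
        simp
      rw [this, ← hvar]
      simp
    have i3 : Integrable (fun ω => (1 + U ω * Complex.I - (U ω : ℂ) ^ 2 / 2)) P := by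
      have i1 : Integrable (fun ω => (U ω : ℂ) * Complex.I) P := hint.ofReal.mul_const _
      have i2 : Integrable (fun ω => (U ω : ℂ) ^ 2 / 2) P := by
        have := hsq.ofReal (𝕜 := ℂ)
        simp only [Complex.coe_algebraMap, Complex.ofReal_pow] at this
        exact this.div_const _
      exact ((integrable_const _).add i1).sub i2
    rw [e, expI, ← integral_sub (integrable_exp_mul_I hU.aestronglyMeasurable) i3]
    refine (norm_integral_le_of_norm_le ((hsq.const_mul η).add (hU'.const_mul (4 * η ^ (-δ))))
      (Eventually.of_forall fun ω => norm_exp_sub_taylor_le hδ hη hη1 (U ω))).trans ?_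
    simp only [Pi.add_apply]
    rw [integral_add (hsq.const_mul η) (hU'.const_mul (4 * η ^ (-δ))), integral_const_mul,
      integral_const_mul, ← hvar]
  have h2 : ‖((1 - v / 2 : ℝ) : ℂ) - Complex.exp (-(v / 2 : ℝ))‖ ≤
      (η ^ 2 + η ^ (-δ) * M) * v := by
    rw [← Complex.ofReal_neg, ← Complex.ofReal_exp, ← Complex.ofReal_sub, Complex.norm_real,
      Real.norm_eq_abs, abs_sub_comm]
    refine (abs_exp_neg_sub_le (by positivity)).trans ?_
    nlinarith
  calc _ ≤ ‖expI P U - (1 - v / 2 : ℝ)‖ + ‖((1 - v / 2 : ℝ) : ℂ) - Complex.exp (-(v / 2 : ℝ))‖ :=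
        norm_sub_le_norm_sub_add_norm_sub _ _ _
    _ ≤ _ := add_le_add h1 h2

/-- A telescoping bound for differences of products in the unit disc. -/
lemma norm_prod_sub_prod_le_sum {ι : Type*} (s : Finset ι) {a b : ι → ℂ}
    (ha : ∀ i, ‖a i‖ ≤ 1) (hb : ∀ i, ‖b i‖ ≤ 1) :
    ‖∏ i ∈ s, a i - ∏ i ∈ s, b i‖ ≤ ∑ i ∈ s, ‖a i - b i‖ := by
  classical
  induction s using Finset.induction with
  | empty => simp
  | insert i s hi ih =>
    rw [Finset.prod_insert hi, Finset.prod_insert hi, Finset.sum_insert hi]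
    have h1 : ‖∏ i ∈ s, b i‖ ≤ 1 := by
      rw [norm_prod]
      exact Finset.prod_le_one (fun _ _ => norm_nonneg _) fun i _ => hb i
    calc ‖a i * ∏ i ∈ s, a i - b i * ∏ i ∈ s, b i‖
        = ‖(a i - b i) * ∏ i ∈ s, b i + a i * (∏ i ∈ s, a i - ∏ i ∈ s, b i)‖ := by ring_nf
      _ ≤ ‖a i - b i‖ * ‖∏ i ∈ s, b i‖ + ‖a i‖ * ‖∏ i ∈ s, a i - ∏ i ∈ s, b i‖ := by
          refine (norm_add_le _ _).trans ?_
          rw [norm_mul, norm_mul]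
      _ ≤ ‖a i - b i‖ * 1 + 1 * ∑ i ∈ s, ‖a i - b i‖ := by
          gcongr
          exact ha i
      _ = _ := by ring

/-- Removing a part `G` of a sum changes its characteristic function by at most `‖G‖_{L²}`. -/
lemma norm_expI_add_sub_expI_le {Ω : Type*} [MeasurableSpace Ω] {P : Measure Ω}
    [IsProbabilityMeasure P] {U G : Ω → ℝ} (hU : MemLp U 2 P) (hG : MemLp G 2 P)
    (h0 : ∫ ω, G ω ∂P = 0) :
    ‖expI P (fun ω => U ω + G ω) - expI P U‖ ≤ √(Var[G; P]) := by
  have hG1 : Integrable G P := hG.integrable one_le_two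
  have hUG : AEStronglyMeasurable (fun ω => U ω + G ω) P :=
    hU.aestronglyMeasurable.add hG.aestronglyMeasurable
  rw [expI, expI, ← integral_sub (integrable_exp_mul_I hUG)
    (integrable_exp_mul_I hU.aestronglyMeasurable)]
  refine (norm_integral_le_of_norm_le hG1.norm (Eventually.of_forall fun ω => ?_)).trans ?_
  · have : Complex.exp (((U ω + G ω : ℝ) : ℂ) * Complex.I) - Complex.exp (U ω * Complex.I) =
        Complex.exp (U ω * Complex.I) * (Complex.exp (Complex.I * G ω) - 1) := by
      rw [mul_sub, ← Complex.exp_add]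
      push_cast
      ring_nf
    rw [this, norm_mul, Complex.norm_exp_ofReal_mul_I, one_mul]
    exact Real.norm_exp_I_mul_ofReal_sub_one_le
  · refine Real.le_sqrt_of_sq_le ?_
    have h1 := variance_nonneg (fun ω => ‖G ω‖) P
    rw [variance_eq_sub hG.norm] at h1
    rw [variance_of_integral_eq_zero hG.aestronglyMeasurable.aemeasurable h0]
    simpa using h1

/-- Cauchy–Schwarz for the variance of a difference. -/
lemma abs_variance_sub_variance_le {Ω : Type*} [MeasurableSpace Ω] {P : Measure Ω}
    [IsProbabilityMeasure P] {U G : Ω → ℝ} (hU : MemLp U 2 P) (hG : MemLp G 2 P) :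
    |Var[U; P] - Var[fun ω => U ω + G ω; P]| ≤
      2 * √(Var[fun ω => U ω + G ω; P] * Var[G; P]) + Var[G; P] := by
  have hS : MemLp (fun ω => U ω + G ω) 2 P := hU.add hG
  have e : U = fun ω => (U ω + G ω) - G ω := by ext; ring
  have h1 : Var[U; P] = Var[fun ω => U ω + G ω; P] -
      2 * cov[fun ω => U ω + G ω, G; P] + Var[G; P] := by
    conv_lhs => rw [e]
    exact variance_fun_sub hS hG
  have h2 : |cov[fun ω => U ω + G ω, G; P]| ≤ √(Var[fun ω => U ω + G ω; P] * Var[G; P]) := by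
    refine Real.abs_le_sqrt ?_
    have hd := discrim_le_zero (a := Var[G; P]) (b := -2 * cov[fun ω => U ω + G ω, G; P])
      (c := Var[fun ω => U ω + G ω; P]) fun c => by
        have h4 := variance_nonneg (fun ω => (U ω + G ω) - c * G ω) P
        rw [variance_fun_sub hS (hG.const_mul c), variance_const_mul,
          covariance_const_mul_right] at h4
        linarith
    rw [discrim] at hd
    linarith
  have h3 := variance_nonneg G P
  rw [h1]
  have := abs_le.1 h2
  rw [abs_le]
  constructor <;> linarith

end DoublyStochastic

/-! ### Bernstein blocks -/

namespace DoublyStochastic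

/-- Among the `m` ways of declaring one block of length `b` out of `m` consecutive ones a gap,
one carries at most the fraction `1 / m` of the total of `F`. -/
lemma exists_gap_le {b m : ℕ} (hm : 0 < m) (I : Finset ℕ) {F : ℕ → ℕ → ℝ}
    (hF : ∀ i j, 0 ≤ F i j) {T : ℝ} (hT : ∑ i ∈ I, ∑ j ∈ I, F i j ≤ T) :
    ∃ c, ∑ i ∈ I with (i / b + c) % m = m - 1, ∑ j ∈ I with (j / b + c) % m = m - 1, F i j ≤
      T / m := by
  have h1 : ∑ c ∈ Finset.range m, ∑ i ∈ I with (i / b + c) % m = m - 1,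
      ∑ j ∈ I with (j / b + c) % m = m - 1, F i j ≤ ∑ c ∈ Finset.range m, T / m := by
    have hm' : (m : ℝ) ≠ 0 := by exact_mod_cast hm.ne'
    rw [Finset.sum_const, Finset.card_range, nsmul_eq_mul, mul_div_cancel₀ _ hm']
    refine le_trans ?_ hT
    calc _ ≤ ∑ c ∈ Finset.range m, ∑ i ∈ I with (i / b + c) % m = m - 1, ∑ j ∈ I, F i j := by
          refine Finset.sum_le_sum fun c _ => Finset.sum_le_sum fun i _ => ?_
          exact Finset.sum_le_sum_of_subset_of_nonneg (Finset.filter_subset _ _)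
            fun j _ _ => hF i j
      _ = ∑ i ∈ I, ∑ c ∈ Finset.range m with (i / b + c) % m = m - 1, ∑ j ∈ I, F i j := by
          simp only [Finset.sum_filter]
          rw [Finset.sum_comm]
      _ ≤ ∑ i ∈ I, ∑ j ∈ I, F i j := by
          refine Finset.sum_le_sum fun i _ => ?_
          have h0 : 0 ≤ ∑ j ∈ I, F i j := Finset.sum_nonneg fun j _ => hF i j
          rw [Finset.sum_const, nsmul_eq_mul]
          refine mul_le_of_le_one_left h0 ?_
          have : (Finset.filter (fun c => (i / b + c) % m = m - 1) (Finset.range m)).card ≤ 1 := by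
            refine Finset.card_le_one.2 fun c hc c' hc' => ?_
            simp only [Finset.mem_filter, Finset.mem_range] at hc hc'
            have : i / b + c ≡ i / b + c' [MOD m] := hc.2.trans hc'.2.symm
            exact Nat.ModEq.eq_of_lt_of_lt (Nat.ModEq.add_left_cancel' _ this) hc.1 hc'.1
          exact_mod_cast this
  obtain ⟨c, -, hc⟩ := Finset.exists_le_of_sum_le (Finset.nonempty_range_iff.2 hm.ne') h1
  exact ⟨c, hc⟩

/-- Outside the gaps, distinct large blocks are more than `b` apart. -/
lemma add_lt_of_block_lt {b m c i j : ℕ} (hb : 0 < b) (hi : (i / b + c) % m ≠ m - 1)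
    (hij : (i / b + c) / m < (j / b + c) / m) : i + b < j := by
  have hm : 0 < m := by
    rcases Nat.eq_zero_or_pos m with rfl | h
    · simp at hij
    · exact h
  have h1 := Nat.div_add_mod (i / b + c) m
  have h2 := Nat.div_mul_le_self (j / b + c) m
  have h3 := Nat.mod_lt (i / b + c) hm
  have h4 : m * ((i / b + c) / m + 1) ≤ m * ((j / b + c) / m) := Nat.mul_le_mul_left m hij
  rw [mul_comm ((j / b + c) / m)] at h2
  rw [mul_add, mul_one] at h4
  have h5 : i / b + 2 ≤ j / b := by omega
  have h6 := Nat.div_add_mod i b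
  have h7 := Nat.mod_lt i hb
  have h8 := Nat.div_mul_le_self j b
  have h9 : b * (i / b + 2) ≤ b * (j / b) := Nat.mul_le_mul_left b h5
  rw [mul_comm (j / b)] at h8
  rw [mul_add] at h9
  omega

lemma card_block_le {b m c n : ℕ} (hb : 0 < b) (hm : 0 < m) (I : Finset ℕ) :
    (I.filter fun i => (i / b + c) / m = n).card ≤ b * m := by
  have h : ((I.filter fun i => (i / b + c) / m = n).map (addRightEmbedding (c * b))) ⊆
      Finset.Ico (b * m * n) (b * m * n + b * m) := by
    intro x hx
    simp only [Finset.mem_map, Finset.mem_filter, addRightEmbedding_apply] at hx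
    obtain ⟨i, ⟨-, hi⟩, rfl⟩ := hx
    rw [← Nat.add_mul_div_right i c hb, Nat.div_div_eq_div_mul] at hi
    have h1 := Nat.div_add_mod (i + c * b) (b * m)
    have h2 := Nat.mod_lt (i + c * b) (Nat.mul_pos hb hm)
    rw [hi] at h1
    rw [Finset.mem_Ico]
    omega
  have := Finset.card_le_card h
  simpa using this

/-- Power-mean bound for the Lyapunov moment of a sum. -/
lemma integral_abs_sum_rpow_le {ι Ω : Type*} [MeasurableSpace Ω] {P : Measure Ω}
    {X : ι → Ω → ℝ} {p : ℝ} (hp : 1 ≤ p)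
    (hm : ∀ i, AEStronglyMeasurable (X i) P)
    (hX : ∀ i, Integrable (fun ω => |X i ω| ^ p) P) (s : Finset ι) {n : ℝ} (hn : (s.card : ℝ) ≤ n) :
    Integrable (fun ω => |∑ i ∈ s, X i ω| ^ p) P ∧
      ∫ ω, |∑ i ∈ s, X i ω| ^ p ∂P ≤ n ^ (p - 1) * ∑ i ∈ s, ∫ ω, |X i ω| ^ p ∂P := by
  have hb : ∀ ω, |∑ i ∈ s, X i ω| ^ p ≤ n ^ (p - 1) * ∑ i ∈ s, |X i ω| ^ p := by
    intro ω
    calc |∑ i ∈ s, X i ω| ^ p ≤ (∑ i ∈ s, |X i ω|) ^ p :=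
          Real.rpow_le_rpow (abs_nonneg _) (Finset.abs_sum_le_sum_abs _ _) (by linarith)
      _ ≤ (s.card : ℝ) ^ (p - 1) * ∑ i ∈ s, |X i ω| ^ p :=
          Real.rpow_sum_le_const_mul_sum_rpow s _ hp
      _ ≤ _ := by
          gcongr
  have hi : Integrable (fun ω => n ^ (p - 1) * ∑ i ∈ s, |X i ω| ^ p) P :=
    (integrable_finsetSum s fun i _ => hX i).const_mul _
  have hm' : AEStronglyMeasurable (fun ω => |∑ i ∈ s, X i ω| ^ p) P := by
    have h1 : AEStronglyMeasurable (fun ω => ∑ i ∈ s, X i ω) P :=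
      Finset.aestronglyMeasurable_fun_sum s fun i _ => hm i
    exact (h1.aemeasurable.abs.pow_const p).aestronglyMeasurable
  have hint : Integrable (fun ω => |∑ i ∈ s, X i ω| ^ p) P := by
    refine hi.mono' hm' (Eventually.of_forall fun ω => ?_)
    rw [Real.norm_of_nonneg (by positivity)]
    exact hb ω
  refine ⟨hint, (integral_mono hint hi hb).trans (le_of_eq ?_)⟩
  rw [integral_const_mul, integral_finsetSum s fun i _ => hX i]

variable {Ω : Type*} [MeasurableSpace Ω] {P : Measure Ω} [IsProbabilityMeasure P]

/-- If characteristic functions of sums over `b`-separated index sets nearly factorize, then the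
one of a sum of `b`-separated blocks is nearly the product over the blocks. -/
lemma norm_expI_sum_sub_prod_le {X : ℕ → Ω → ℝ} {w : ℕ → ℝ} (hw : ∀ i, 0 ≤ w i) {ρ : ℝ}
    (hρ : 0 ≤ ρ) {b : ℕ} (I : Finset ℕ) (J : ℕ → ℕ) (K : ℕ) (hJ : ∀ i ∈ I, J i < K)
    (hsep : ∀ i ∈ I, ∀ j ∈ I, J i < J j → i + b < j)
    (hfac : ∀ A B : Finset ℕ, A ⊆ I → B ⊆ I → (∀ i ∈ A, ∀ j ∈ B, i + b < j) →
      ‖expI P (fun ω => ∑ i ∈ A, X i ω + ∑ i ∈ B, X i ω) -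
        expI P (fun ω => ∑ i ∈ A, X i ω) * expI P (fun ω => ∑ i ∈ B, X i ω)‖ ≤
        ρ * (∑ i ∈ A, w i) * ∑ i ∈ B, w i) :
    ‖expI P (fun ω => ∑ i ∈ I, X i ω) -
      ∏ n ∈ Finset.range K, expI P (fun ω => ∑ i ∈ I with J i = n, X i ω)‖ ≤
      ρ * (∑ i ∈ I, w i) ^ 2 := by
  set W := ∑ i ∈ I, w i with hW
  have hsub : ∀ p : ℕ → Prop, [DecidablePred p] → ∑ i ∈ I with p i, w i ≤ W := fun p _ =>
    Finset.sum_le_sum_of_subset_of_nonneg (Finset.filter_subset _ _) fun i _ _ => hw i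
  have hpos : ∀ s : Finset ℕ, 0 ≤ ∑ i ∈ s, w i := fun s => Finset.sum_nonneg fun i _ => hw i
  -- The blocks are split off one at a time, the last one first.
  have key : ∀ k, ‖expI P (fun ω => ∑ i ∈ I with J i < k, X i ω) -
      ∏ n ∈ Finset.range k, expI P (fun ω => ∑ i ∈ I with J i = n, X i ω)‖ ≤
      ρ * W * ∑ i ∈ I with J i < k, w i := by
    intro k
    induction k with
    | zero => simp [expI]
    | succ k ih =>
      have hdis : Disjoint (I.filter fun i => J i < k) (I.filter fun i => J i = k) := by
        refine Finset.disjoint_filter.2 fun i _ h => ?_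
        omega
      have hun : (I.filter fun i => J i < k + 1) =
          (I.filter fun i => J i < k) ∪ (I.filter fun i => J i = k) := by
        rw [← Finset.filter_or]
        exact Finset.filter_congr fun i _ => Nat.lt_succ_iff_lt_or_eq
      have h1 := hfac _ _ (Finset.filter_subset (fun i => J i < k) I)
        (Finset.filter_subset (fun i => J i = k) I) fun i hi j hj => by
          simp only [Finset.mem_filter] at hi hj
          exact hsep i hi.1 j hj.1 (by omega)
      rw [hun, Finset.sum_union hdis, Finset.prod_range_succ]
      simp only [Finset.sum_union hdis]
      set a := expI P (fun ω => ∑ i ∈ I with J i < k, X i ω)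
      set c := expI P (fun ω => ∑ i ∈ I with J i = k, X i ω)
      set p := ∏ n ∈ Finset.range k, expI P (fun ω => ∑ i ∈ I with J i = n, X i ω)
      set e := expI P (fun ω => ∑ i ∈ I with J i < k, X i ω + ∑ i ∈ I with J i = k, X i ω)
      calc ‖e - p * c‖ = ‖(e - a * c) + (a - p) * c‖ := by ring_nf
        _ ≤ ‖e - a * c‖ + ‖a - p‖ * ‖c‖ := by
            refine (norm_add_le _ _).trans ?_
            rw [norm_mul]
        _ ≤ ρ * W * (∑ i ∈ I with J i = k, w i) + (ρ * W * ∑ i ∈ I with J i < k, w i) * 1 := by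
            gcongr
            · refine h1.trans ?_
              gcongr
              · exact hpos _
              · exact hsub _
            · exact mul_nonneg (mul_nonneg hρ (hpos _)) (hpos _)
            · exact norm_expI_le_one P _
        _ = _ := by ring
  have hI : (I.filter fun i => J i < K) = I := Finset.filter_true_of_mem hJ
  have := key K
  rw [hI] at this
  refine this.trans (le_of_eq ?_)
  ring

/-- The variance of a sum of `b`-separated blocks is nearly the sum of the block variances. -/
lemma abs_variance_sum_sub_sum_variance_le {X : ℕ → Ω → ℝ} (hX : ∀ i, MemLp (X i) 2 P)
    {w : ℕ → ℝ} (hw : ∀ i, 0 ≤ w i) {ρ : ℝ}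
    (hρ : 0 ≤ ρ) {b : ℕ} (I : Finset ℕ) (J : ℕ → ℕ) (K : ℕ) (hJ : ∀ i ∈ I, J i < K)
    (hsep : ∀ i ∈ I, ∀ j ∈ I, J i < J j → i + b < j)
    (hcov : ∀ i j, i + b < j → |cov[X i, X j; P]| ≤ ρ * w i * w j) :
    |Var[fun ω => ∑ i ∈ I, X i ω; P] -
      ∑ n ∈ Finset.range K, Var[fun ω => ∑ i ∈ I with J i = n, X i ω; P]| ≤
      ρ * (∑ i ∈ I, w i) ^ 2 := by
  have hvar : ∀ s : Finset ℕ, Var[fun ω => ∑ i ∈ s, X i ω; P] =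
      ∑ i ∈ s, ∑ j ∈ s, cov[X i, X j; P] := by
    intro s
    rw [← covariance_self (memLp_finsetSum _ fun i _ => hX i).aestronglyMeasurable.aemeasurable]
    exact covariance_fun_sum_fun_sum' (fun i _ => hX i) (fun i _ => hX i)
  have h1 : ∑ n ∈ Finset.range K, Var[fun ω => ∑ i ∈ I with J i = n, X i ω; P] =
      ∑ i ∈ I, ∑ j ∈ I, if J i = J j then cov[X i, X j; P] else 0 := by
    rw [Finset.sum_congr rfl fun n _ => hvar _]
    simp only [Finset.sum_filter]
    rw [Finset.sum_comm]
    refine Finset.sum_congr rfl fun i hi => ?_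
    rw [Finset.sum_ite_eq (Finset.range K) (J i), if_pos (Finset.mem_range.2 (hJ i hi))]
    exact Finset.sum_congr rfl fun j _ => by simp only [eq_comm]
  rw [hvar, h1, ← Finset.sum_sub_distrib, sq, Finset.sum_mul_sum, Finset.mul_sum]
  refine (Finset.abs_sum_le_sum_abs _ _).trans (Finset.sum_le_sum fun i hi => ?_)
  rw [← Finset.sum_sub_distrib, Finset.mul_sum]
  refine (Finset.abs_sum_le_sum_abs _ _).trans (Finset.sum_le_sum fun j hj => ?_)
  split_ifs with h
  · rw [sub_self, abs_zero]
    exact mul_nonneg hρ (mul_nonneg (hw i) (hw j))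
  · rw [sub_zero, ← mul_assoc]
    rcases lt_or_gt_of_ne h with h | h
    · exact hcov i j (hsep i hi j hj h)
    · rw [covariance_comm, mul_assoc, mul_comm (w i), ← mul_assoc]
      exact hcov j i (hsep j hj i hi h)

/-- The blocking estimate. The error terms are, in order: removal of the gaps (`T / m`),
factorization over the large blocks (`ρ W²`), Lyapunov's bound for each block
(`(b m)^{1 + δ} H`), with the threshold `η` free, and the difference `d` between the total variance
and the sum of the variances of the large blocks. -/
theorem norm_expI_sum_sub_exp_variance_le {X : ℕ → Ω → ℝ} (hX : ∀ i, MemLp (X i) 2 P)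
    (h0 : ∀ i, ∫ ω, X i ω ∂P = 0) {δ η : ℝ} (hδ : 0 < δ) (hη : 0 < η) (hη1 : η ≤ 1)
    (hX' : ∀ i, Integrable (fun ω => |X i ω| ^ (2 + δ)) P)
    {w : ℕ → ℝ} (hw : ∀ i, 0 ≤ w i) {ρ : ℝ} (hρ : 0 ≤ ρ) {b m : ℕ} (hb : 0 < b) (hm : 0 < m)
    (I : Finset ℕ)
    (hfac : ∀ A B : Finset ℕ, (∀ i ∈ A, ∀ j ∈ B, i + b < j) →
      ‖expI P (fun ω => ∑ i ∈ A, X i ω + ∑ i ∈ B, X i ω) -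
        expI P (fun ω => ∑ i ∈ A, X i ω) * expI P (fun ω => ∑ i ∈ B, X i ω)‖ ≤
        ρ * (∑ i ∈ A, w i) * ∑ i ∈ B, w i)
    (hcov : ∀ i j, i + b < j → |cov[X i, X j; P]| ≤ ρ * w i * w j)
    {T W H v d : ℝ} (hT : ∑ i ∈ I, ∑ j ∈ I, |cov[X i, X j; P]| ≤ T) (hW : ∑ i ∈ I, w i ≤ W)
    (hH : ∑ i ∈ I, ∫ ω, |X i ω| ^ (2 + δ) ∂P ≤ H)
    (hv : v = Var[fun ω => ∑ i ∈ I, X i ω; P])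
    (hd : d = 2 * √(v * (T / m)) + T / m + ρ * W ^ 2) :
    ‖expI P (fun ω => ∑ i ∈ I, X i ω) - Complex.exp (-(v / 2 : ℝ))‖ ≤
      √(T / m) + ρ * W ^ 2 + (η * (v + d) + 4 * η ^ (-δ) * (((b * m : ℕ) : ℝ) ^ (1 + δ) * H) +
        (η ^ 2 + η ^ (-δ) * (((b * m : ℕ) : ℝ) ^ (1 + δ) * H)) * (v + d)) + d := by
  obtain ⟨c, hc⟩ := exists_gap_le (b := b) hm I (F := fun i j => |cov[X i, X j; P]|)
    (fun i j => abs_nonneg _) hT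
  -- `I₀` collects the gaps, `I₁` the rest; `J i` is the number of the large block containing `i`.
  set I₀ := I.filter fun i => (i / b + c) % m = m - 1 with hI₀
  set I₁ := I.filter fun i => ¬ (i / b + c) % m = m - 1 with hI₁
  set J : ℕ → ℕ := fun i => (i / b + c) / m with hJdef
  set K : ℕ := I₁.sup J + 1 with hK
  have hJ : ∀ i ∈ I₁, J i < K := fun i hi => Nat.lt_succ_of_le (Finset.le_sup hi)
  have hsep : ∀ i ∈ I₁, ∀ j ∈ I₁, J i < J j → i + b < j := fun i hi j _ h =>
    add_lt_of_block_lt hb (Finset.mem_filter.1 hi).2 h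
  have hLp : ∀ s : Finset ℕ, MemLp (fun ω => ∑ i ∈ s, X i ω) 2 P := fun s =>
    memLp_finsetSum _ fun i _ => hX i
  have hmean : ∀ s : Finset ℕ, ∫ ω, ∑ i ∈ s, X i ω ∂P = 0 := fun s => by
    rw [integral_finsetSum s fun i _ => (hX i).integrable one_le_two]
    exact Finset.sum_eq_zero fun i _ => h0 i
  have hsplit : ∀ ω, ∑ i ∈ I, X i ω = ∑ i ∈ I₁, X i ω + ∑ i ∈ I₀, X i ω := fun ω => by
    rw [add_comm, hI₀, hI₁, Finset.sum_filter_add_sum_filter_not]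
  have hW1 : ∑ i ∈ I₁, w i ≤ W := (Finset.sum_le_sum_of_subset_of_nonneg
    (Finset.filter_subset _ _) fun i _ _ => hw i).trans hW
  have hW0 : 0 ≤ ∑ i ∈ I₁, w i := Finset.sum_nonneg fun i _ => hw i
  have hW2 : ρ * (∑ i ∈ I₁, w i) ^ 2 ≤ ρ * W ^ 2 := by gcongr
  set q := Var[fun ω => ∑ i ∈ I₁, X i ω; P] with hq
  set B : ℕ → Finset ℕ := fun n => I₁.filter fun i => J i = n with hB
  set Q := ∑ n ∈ Finset.range K, Var[fun ω => ∑ i ∈ B n, X i ω; P] with hQ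
  have hgap : Var[fun ω => ∑ i ∈ I₀, X i ω; P] ≤ T / m := by
    rw [← covariance_self (hLp I₀).aestronglyMeasurable.aemeasurable,
      covariance_fun_sum_fun_sum' (fun i _ => hX i) (fun i _ => hX i)]
    exact (Finset.sum_le_sum fun i _ => Finset.sum_le_sum fun j _ => le_abs_self _).trans hc
  have hgap0 := variance_nonneg (fun ω => ∑ i ∈ I₀, X i ω) P
  have hv0 : 0 ≤ v := hv ▸ variance_nonneg _ _
  have e1 : ‖expI P (fun ω => ∑ i ∈ I, X i ω) - expI P (fun ω => ∑ i ∈ I₁, X i ω)‖ ≤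
      √(T / m) := by
    simp_rw [hsplit]
    exact (norm_expI_add_sub_expI_le (hLp I₁) (hLp I₀) (hmean I₀)).trans (Real.sqrt_le_sqrt hgap)
  have e2 : |q - v| ≤ 2 * √(v * (T / m)) + T / m := by
    have := abs_variance_sub_variance_le (hLp I₁) (hLp I₀)
    simp_rw [← hsplit] at this
    rw [← hv] at this
    refine this.trans ?_
    gcongr
  have e3 : ‖expI P (fun ω => ∑ i ∈ I₁, X i ω) -
      ∏ n ∈ Finset.range K, expI P (fun ω => ∑ i ∈ B n, X i ω)‖ ≤ ρ * W ^ 2 :=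
    (norm_expI_sum_sub_prod_le hw hρ I₁ J K hJ hsep
      fun A B _ _ => hfac A B).trans hW2
  have e4 : |q - Q| ≤ ρ * W ^ 2 :=
    (abs_variance_sum_sub_sum_variance_le hX hw hρ I₁ J K hJ hsep hcov).trans hW2
  have e5 : |Q - v| ≤ d := by
    have h1 := abs_le.1 e2
    have h2 := abs_le.1 e4
    rw [hd, abs_le]
    constructor <;> linarith
  have hQv : Q ≤ v + d := by linarith [(abs_le.1 e5).2]
  have hQ0 : 0 ≤ Q := Finset.sum_nonneg fun n _ => variance_nonneg _ _
  have hmom : ∀ n, Integrable (fun ω => |∑ i ∈ B n, X i ω| ^ (2 + δ)) P ∧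
      ∫ ω, |∑ i ∈ B n, X i ω| ^ (2 + δ) ∂P ≤
        ((b * m : ℕ) : ℝ) ^ (1 + δ) * ∑ i ∈ B n, ∫ ω, |X i ω| ^ (2 + δ) ∂P := fun n => by
    have := integral_abs_sum_rpow_le (by linarith : (1 : ℝ) ≤ 2 + δ)
      (fun i => (hX i).aestronglyMeasurable) hX' (B n) (n := ((b * m : ℕ) : ℝ))
      (by exact_mod_cast card_block_le hb hm I₁)
    rwa [show 2 + δ - 1 = 1 + δ by ring] at this
  set L := ((b * m : ℕ) : ℝ) ^ (1 + δ) * H with hL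
  have hLy : ∑ n ∈ Finset.range K, ∫ ω, |∑ i ∈ B n, X i ω| ^ (2 + δ) ∂P ≤ L := by
    refine (Finset.sum_le_sum fun n _ => (hmom n).2).trans ?_
    rw [← Finset.mul_sum]
    refine mul_le_mul_of_nonneg_left (le_trans ?_ hH) (by positivity)
    have hnn : ∀ i, 0 ≤ ∫ ω, |X i ω| ^ (2 + δ) ∂P := fun i =>
      integral_nonneg fun ω => by positivity
    calc ∑ n ∈ Finset.range K, ∑ i ∈ B n, ∫ ω, |X i ω| ^ (2 + δ) ∂P
        = ∑ i ∈ I₁, ∫ ω, |X i ω| ^ (2 + δ) ∂P :=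
          Finset.sum_fiberwise_of_maps_to (fun i hi => Finset.mem_range.2 (hJ i hi)) _
      _ ≤ _ := Finset.sum_le_sum_of_subset_of_nonneg (Finset.filter_subset _ _)
          fun i _ _ => hnn i
  set Mm : ℕ → ℝ := fun n => ∫ ω, |∑ i ∈ B n, X i ω| ^ (2 + δ) ∂P with hMm
  set vv : ℕ → ℝ := fun n => Var[fun ω => ∑ i ∈ B n, X i ω; P] with hvv
  have hMm0 : ∀ n, 0 ≤ Mm n := fun n => integral_nonneg fun ω => by positivity
  have hvv0 : ∀ n, 0 ≤ vv n := fun n => variance_nonneg _ _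
  have hη' : 0 ≤ η ^ (-δ) := by positivity
  -- In the quadratic error term one factor is bounded by the total Lyapunov sum `L`, which leaves
  -- a sum of variances.
  have e6 : ‖∏ n ∈ Finset.range K, expI P (fun ω => ∑ i ∈ B n, X i ω) -
      ∏ n ∈ Finset.range K, Complex.exp (-(vv n / 2 : ℝ))‖ ≤
      η * (v + d) + 4 * η ^ (-δ) * L + (η ^ 2 + η ^ (-δ) * L) * (v + d) := by
    refine (norm_prod_sub_prod_le_sum _ (fun n => norm_expI_le_one _ _) fun n => ?_).trans ?_
    · rw [← Complex.ofReal_neg, ← Complex.ofReal_exp, Complex.norm_real, Real.norm_eq_abs,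
        abs_of_pos (Real.exp_pos _), Real.exp_le_one_iff]
      linarith [hvv0 n]
    · calc _ ≤ ∑ n ∈ Finset.range K, (η * vv n + 4 * η ^ (-δ) * Mm n +
            (η ^ 2 + η ^ (-δ) * L) * vv n) := by
            refine Finset.sum_le_sum fun n hn => ?_
            refine (norm_expI_sub_exp_le hδ hη hη1 (hLp _) (hmean _) (hmom n).1).trans ?_
            gcongr
            · exact hvv0 n
            · exact (Finset.single_le_sum (fun n _ => hMm0 n) hn).trans hLy
        _ = η * Q + 4 * η ^ (-δ) * ∑ n ∈ Finset.range K, Mm n +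
            (η ^ 2 + η ^ (-δ) * L) * Q := by
            rw [Finset.sum_add_distrib, Finset.sum_add_distrib, ← Finset.mul_sum,
              ← Finset.mul_sum, ← Finset.mul_sum]
        _ ≤ _ := by
            have hL0 : 0 ≤ L := (Finset.sum_nonneg fun n _ => hMm0 n).trans hLy
            gcongr
  -- The product of the Gaussian factors is Gaussian with variance `Q`, and `x ↦ e^{-x}` is
  -- `1`-Lipschitz on the half-line.
  have e7 : ‖∏ n ∈ Finset.range K, Complex.exp (-(vv n / 2 : ℝ)) -
      Complex.exp (-(v / 2 : ℝ))‖ ≤ d := by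
    have : ∏ n ∈ Finset.range K, Complex.exp (-(vv n / 2 : ℝ)) =
        ((Real.exp (-(Q / 2)) : ℝ) : ℂ) := by
      rw [← Complex.exp_sum, Complex.ofReal_exp]
      congr 1
      rw [hQ, Finset.sum_div]
      push_cast
      rw [Finset.sum_neg_distrib]
    rw [this, ← Complex.ofReal_neg (v / 2), ← Complex.ofReal_exp, ← Complex.ofReal_sub,
      Complex.norm_real, Real.norm_eq_abs]
    have hlip : ∀ x y : ℝ, 0 ≤ x → 0 ≤ y → Real.exp (-x) - Real.exp (-y) ≤ |x - y| := by
      intro x y hx hy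
      have h1 := Real.one_sub_le_exp_neg (y - x)
      have h2 : Real.exp (-y) = Real.exp (-x) * Real.exp (-(y - x)) := by
        rw [← Real.exp_add]; ring_nf
      have h3 : Real.exp (-x) ≤ 1 := Real.exp_le_one_iff.2 (by linarith)
      have h4 := Real.exp_pos (-x)
      have h5 := neg_abs_le (x - y)
      have h6 := abs_nonneg (x - y)
      rw [h2]
      nlinarith
    have h1 := hlip (Q / 2) (v / 2) (by linarith) (by linarith)
    have h2 := hlip (v / 2) (Q / 2) (by linarith) (by linarith)
    rw [abs_sub_comm] at h2
    have h3 : |Q / 2 - v / 2| = |Q - v| / 2 := by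
      rw [← sub_div, abs_div, abs_two]
    have h4 := abs_nonneg (Q - v)
    rw [abs_le]
    constructor <;> linarith
  calc _ ≤ ‖expI P (fun ω => ∑ i ∈ I, X i ω) - expI P (fun ω => ∑ i ∈ I₁, X i ω)‖ +
        ‖expI P (fun ω => ∑ i ∈ I₁, X i ω) -
          ∏ n ∈ Finset.range K, expI P (fun ω => ∑ i ∈ B n, X i ω)‖ +
        ‖∏ n ∈ Finset.range K, expI P (fun ω => ∑ i ∈ B n, X i ω) -
          ∏ n ∈ Finset.range K, Complex.exp (-(vv n / 2 : ℝ))‖ +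
        ‖∏ n ∈ Finset.range K, Complex.exp (-(vv n / 2 : ℝ)) - Complex.exp (-(v / 2 : ℝ))‖ := by
        refine le_trans (le_of_eq ?_) ((norm_add_le _ _).trans (add_le_add_left
          ((norm_add_le _ _).trans (add_le_add_left (norm_add_le _ _) _)) _))
        congr 1
        ring
    _ ≤ _ := by linarith

end DoublyStochastic

/-! ### A central limit theorem with polynomial decoupling -/

namespace DoublyStochastic

lemma tendsto_natCast_rpow_of_neg {a : ℝ} (ha : a < 0) (C : ℝ) :
    Tendsto (fun N : ℕ => C * (N : ℝ) ^ a) atTop (𝓝 0) := by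
  have h := (tendsto_rpow_neg_atTop (neg_pos.2 ha)).comp (tendsto_natCast_atTop_atTop (R := ℝ))
  simpa [Function.comp_def] using h.const_mul C

/-- Central limit theorem for a sequence whose characteristic functions decouple at polynomial
rate `k`. The gaps have length `N^β` and the large blocks are longer by the factor `N^{2ε}`. The
growth assumptions carry a loss of `N^ε`: `hβ` makes the decoupling error negligible and `hβ'`
makes Lyapunov's ratio vanish. -/
theorem tendsto_expI_of_decoupling {Ω : Type*} [MeasurableSpace Ω] {P : Measure Ω}
    [IsProbabilityMeasure P] {ξ : ℕ → Ω → ℝ} (hξ : ∀ i, MemLp (ξ i) 2 P)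
    (h0 : ∀ i, ∫ ω, ξ i ω ∂P = 0) {δ : ℝ} (hδ : 0 < δ)
    (hξ' : ∀ i, Integrable (fun ω => |ξ i ω| ^ (2 + δ)) P)
    {w : ℕ → ℝ} (hw : ∀ i, 0 ≤ w i) {D k : ℝ} (hD : 0 ≤ D) (hk : 0 ≤ k)
    (hfac : ∀ (s : ℝ) (r : ℕ) (A B : Finset ℕ), (∀ i ∈ A, ∀ j ∈ B, i + r < j) →
      ‖expI P (fun ω => ∑ i ∈ A, s * ξ i ω + ∑ i ∈ B, s * ξ i ω) -
        expI P (fun ω => ∑ i ∈ A, s * ξ i ω) * expI P (fun ω => ∑ i ∈ B, s * ξ i ω)‖ ≤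
        D * s ^ 2 * ((r : ℝ) + 1) ^ (-k) * (∑ i ∈ A, w i) * ∑ i ∈ B, w i)
    (hcov : ∀ i j r : ℕ, i + r < j → |cov[ξ i, ξ j; P]| ≤ D * ((r : ℝ) + 1) ^ (-k) * w i * w j)
    {β ε C : ℝ} (hε : 0 < ε) (hβ0 : 0 ≤ β) (hβ : 1 + 2 * ε < k * β)
    (hβ' : (1 + δ) * (β + 2 * ε) + ε < δ / 2)
    (hgw : ∀ N : ℕ, ∑ i ∈ Finset.Icc 1 N, w i ≤ C * (N : ℝ) ^ (1 + ε))
    (hgm : ∀ N : ℕ, ∑ i ∈ Finset.Icc 1 N, ∫ ω, |ξ i ω| ^ (2 + δ) ∂P ≤ C * (N : ℝ) ^ (1 + ε))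
    (hgc : ∀ N : ℕ, ∑ i ∈ Finset.Icc 1 N, ∑ j ∈ Finset.Icc 1 N, |cov[ξ i, ξ j; P]| ≤
      C * (N : ℝ) ^ (1 + ε))
    {σ2 : ℝ} (hvar : Tendsto (fun N : ℕ =>
      Var[fun ω => ∑ i ∈ Finset.Icc 1 N, (√N)⁻¹ * ξ i ω; P]) atTop (𝓝 σ2)) :
    Tendsto (fun N : ℕ => expI P fun ω => ∑ i ∈ Finset.Icc 1 N, (√N)⁻¹ * ξ i ω) atTop
      (𝓝 (Complex.exp (-(σ2 / 2 : ℝ)))) := by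
  set b : ℕ → ℕ := fun N => ⌈(N : ℝ) ^ β⌉₊ with hb
  set m : ℕ → ℕ := fun N => ⌈(N : ℝ) ^ (2 * ε)⌉₊ with hm
  set s : ℕ → ℝ := fun N => (√(N : ℝ))⁻¹ with hs
  set v : ℕ → ℝ := fun N => Var[fun ω => ∑ i ∈ Finset.Icc 1 N, s N * ξ i ω; P] with hv
  set T : ℕ → ℝ := fun N => s N ^ 2 * (C * (N : ℝ) ^ (1 + ε)) with hT
  set W : ℕ → ℝ := fun N => C * (N : ℝ) ^ (1 + ε) with hW
  set ρ : ℕ → ℝ := fun N => D * s N ^ 2 * ((b N : ℝ) + 1) ^ (-k) with hρ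
  set H : ℕ → ℝ := fun N => s N ^ (2 + δ) * (C * (N : ℝ) ^ (1 + ε)) with hH
  set L : ℕ → ℝ := fun N => ((b N * m N : ℕ) : ℝ) ^ (1 + δ) * H N with hL
  set d : ℕ → ℝ := fun N => 2 * √(v N * (T N / m N)) + T N / m N + ρ N * W N ^ 2 with hd
  have hC : 0 ≤ C := by
    have := (Finset.sum_nonneg fun i _ => hw i).trans (hgw 1)
    simpa using this
  have hs0 : ∀ N, 0 ≤ s N := fun N => by positivity
  have hs2 : ∀ N : ℕ, s N ^ 2 = (N : ℝ)⁻¹ := fun N => by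
    simp only [hs, inv_pow]
    rw [Real.sq_sqrt (Nat.cast_nonneg N)]
  have hpos : ∀ N : ℕ, 1 ≤ N → (0 : ℝ) < N := fun N hN => by exact_mod_cast hN
  have hbl : ∀ N : ℕ, (N : ℝ) ^ β ≤ b N := fun N => Nat.le_ceil _
  have hml : ∀ N : ℕ, (N : ℝ) ^ (2 * ε) ≤ m N := fun N => Nat.le_ceil _
  have hceil : ∀ (a : ℝ), 0 ≤ a → ∀ N : ℕ, 1 ≤ N →
      ((⌈(N : ℝ) ^ a⌉₊ : ℕ) : ℝ) ≤ 2 * (N : ℝ) ^ a := by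
    intro a ha N hN
    have h1 : (1 : ℝ) ≤ (N : ℝ) ^ a := Real.one_le_rpow (by exact_mod_cast hN) ha
    have h2 := Nat.ceil_lt_add_one (a := (N : ℝ) ^ a) (by positivity)
    linarith
  have hb0 : ∀ N : ℕ, 1 ≤ N → 0 < b N := fun N hN =>
    Nat.ceil_pos.2 (Real.rpow_pos_of_pos (hpos N hN) _)
  have hm0 : ∀ N : ℕ, 1 ≤ N → 0 < m N := fun N hN =>
    Nat.ceil_pos.2 (Real.rpow_pos_of_pos (hpos N hN) _)
  have hv' : Tendsto v atTop (𝓝 σ2) := hvar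
  -- Gap variance: of order `N⁻¹ N^{1 + ε} N^{-2ε}`.
  have tT : Tendsto (fun N => T N / m N) atTop (𝓝 0) := by
    refine squeeze_zero' (Eventually.of_forall fun N => by positivity) ?_
      (tendsto_natCast_rpow_of_neg (neg_lt_zero.2 hε) C)
    filter_upwards [eventually_ge_atTop 1] with N hN
    have hN' := hpos N hN
    have : (0 : ℝ) < (N : ℝ) ^ (2 * ε) := Real.rpow_pos_of_pos hN' _
    calc T N / m N ≤ T N / (N : ℝ) ^ (2 * ε) := by
          gcongr
          exact hml N
      _ = C * (N : ℝ) ^ (-ε) := by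
          simp only [hT, hs2]
          rw [← Real.rpow_neg_one, div_eq_mul_inv, ← Real.rpow_neg hN'.le]
          rw [show (N : ℝ) ^ (-1 : ℝ) * (C * (N : ℝ) ^ (1 + ε)) * (N : ℝ) ^ (-(2 * ε)) =
            C * ((N : ℝ) ^ (-1 : ℝ) * (N : ℝ) ^ (1 + ε) * (N : ℝ) ^ (-(2 * ε))) by ring,
            ← Real.rpow_add hN', ← Real.rpow_add hN']
          ring_nf
  have hρ0 : ∀ N, 0 ≤ ρ N := fun N => by positivity
  -- Decoupling error: of order `N⁻¹ N^{-kβ} N^{2 (1 + ε)}`.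
  have tρ : Tendsto (fun N => ρ N * W N ^ 2) atTop (𝓝 0) := by
    refine squeeze_zero' (Eventually.of_forall fun N => mul_nonneg (hρ0 N) (sq_nonneg _)) ?_
      (tendsto_natCast_rpow_of_neg (a := 1 + 2 * ε - k * β) (by linarith) (D * C ^ 2))
    filter_upwards [eventually_ge_atTop 1] with N hN
    have hN' := hpos N hN
    have h1 : ((b N : ℝ) + 1) ^ (-k) ≤ (N : ℝ) ^ (-(k * β)) := by
      rw [show -(k * β) = β * (-k) by ring, Real.rpow_mul hN'.le]
      refine Real.rpow_le_rpow_of_nonpos (Real.rpow_pos_of_pos hN' _) ?_ (by linarith)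
      linarith [hbl N]
    calc ρ N * W N ^ 2 ≤ (D * s N ^ 2 * (N : ℝ) ^ (-(k * β))) * W N ^ 2 := by
          simp only [hρ]
          gcongr
      _ = D * C ^ 2 * (N : ℝ) ^ (1 + 2 * ε - k * β) := by
          simp only [hW, hs2]
          rw [← Real.rpow_neg_one, mul_pow, sq ((N : ℝ) ^ (1 + ε))]
          rw [show D * (N : ℝ) ^ (-1 : ℝ) * (N : ℝ) ^ (-(k * β)) *
            (C ^ 2 * ((N : ℝ) ^ (1 + ε) * (N : ℝ) ^ (1 + ε))) = D * C ^ 2 *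
            ((N : ℝ) ^ (-1 : ℝ) * (N : ℝ) ^ (-(k * β)) * (N : ℝ) ^ (1 + ε) * (N : ℝ) ^ (1 + ε)) by
              ring, ← Real.rpow_add hN', ← Real.rpow_add hN', ← Real.rpow_add hN']
          ring_nf
  -- Lyapunov sum: of order `N^{(1 + δ) (β + 2ε)} N^{-(1 + δ / 2)} N^{1 + ε}`.
  have tL : Tendsto L atTop (𝓝 0) := by
    refine squeeze_zero' (Eventually.of_forall fun N => by positivity) ?_
      (tendsto_natCast_rpow_of_neg (a := (1 + δ) * (β + 2 * ε) + ε - δ / 2) (by linarith)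
        (4 ^ (1 + δ) * C))
    filter_upwards [eventually_ge_atTop 1] with N hN
    have hN' := hpos N hN
    have h1 : ((b N * m N : ℕ) : ℝ) ≤ 4 * (N : ℝ) ^ (β + 2 * ε) := by
      rw [Real.rpow_add hN']
      push_cast
      calc (b N : ℝ) * m N ≤ (2 * (N : ℝ) ^ β) * (2 * (N : ℝ) ^ (2 * ε)) := by
            gcongr
            · exact hceil β hβ0 N hN
            · exact hceil (2 * ε) (by linarith) N hN
        _ = _ := by ring
    have h2 : s N ^ (2 + δ) = (N : ℝ) ^ (-(1 + δ / 2)) := by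
      simp only [hs]
      rw [Real.sqrt_eq_rpow, ← Real.rpow_neg hN'.le, ← Real.rpow_mul hN'.le]
      ring_nf
    calc L N ≤ (4 * (N : ℝ) ^ (β + 2 * ε)) ^ (1 + δ) * H N := by
          simp only [hL]
          gcongr
      _ = 4 ^ (1 + δ) * C * (N : ℝ) ^ ((1 + δ) * (β + 2 * ε) + ε - δ / 2) := by
          simp only [hH, h2]
          rw [Real.mul_rpow (by norm_num) (by positivity), ← Real.rpow_mul hN'.le]
          rw [show (4 : ℝ) ^ (1 + δ) * (N : ℝ) ^ ((β + 2 * ε) * (1 + δ)) *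
            ((N : ℝ) ^ (-(1 + δ / 2)) * (C * (N : ℝ) ^ (1 + ε))) = 4 ^ (1 + δ) * C *
            ((N : ℝ) ^ ((β + 2 * ε) * (1 + δ)) * (N : ℝ) ^ (-(1 + δ / 2)) *
              (N : ℝ) ^ (1 + ε)) by ring, ← Real.rpow_add hN', ← Real.rpow_add hN']
          ring_nf
  have td : Tendsto d atTop (𝓝 0) := by
    have h1 : Tendsto (fun N => √(v N * (T N / m N))) atTop (𝓝 0) := by
      have := (hv'.mul tT).sqrt
      rwa [mul_zero, Real.sqrt_zero] at this
    simpa using ((h1.const_mul 2).add tT).add tρ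
  have tsq : Tendsto (fun N => √(T N / m N)) atTop (𝓝 0) := by
    have := tT.sqrt
    rwa [Real.sqrt_zero] at this
  have hest : ∀ η : ℝ, 0 < η → η ≤ 1 → ∀ N : ℕ, 1 ≤ N →
      ‖expI P (fun ω => ∑ i ∈ Finset.Icc 1 N, s N * ξ i ω) - Complex.exp (-(v N / 2 : ℝ))‖ ≤
      √(T N / m N) + ρ N * W N ^ 2 + (η * (v N + d N) + 4 * η ^ (-δ) * L N +
        (η ^ 2 + η ^ (-δ) * L N) * (v N + d N)) + d N := by
    intro η hη hη1 N hN
    have habs : ∀ i ω, |s N * ξ i ω| ^ (2 + δ) = s N ^ (2 + δ) * |ξ i ω| ^ (2 + δ) := fun i ω => by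
      rw [abs_mul, abs_of_nonneg (hs0 N), Real.mul_rpow (hs0 N) (abs_nonneg _)]
    have hcc : ∀ i j, cov[fun ω => s N * ξ i ω, fun ω => s N * ξ j ω; P] =
        s N ^ 2 * cov[ξ i, ξ j; P] := fun i j => by
      rw [covariance_const_mul_left, covariance_const_mul_right]
      ring
    refine norm_expI_sum_sub_exp_variance_le (X := fun i ω => s N * ξ i ω)
      (fun i => (hξ i).const_mul _) (fun i => by rw [integral_const_mul, h0, mul_zero]) hδ hη hη1
      (fun i => ?_) hw (hρ0 N) (hb0 N hN) (hm0 N hN) (Finset.Icc 1 N)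
      (fun A B hAB => hfac (s N) (b N) A B hAB) (fun i j hij => ?_) ?_ (hgw N) ?_ rfl rfl
    · simp_rw [habs]
      exact (hξ' i).const_mul _
    · rw [hcc, abs_mul, abs_of_nonneg (sq_nonneg _)]
      calc s N ^ 2 * |cov[ξ i, ξ j; P]| ≤ s N ^ 2 * (D * ((b N : ℝ) + 1) ^ (-k) * w i * w j) := by
            gcongr
            exact hcov i j _ hij
        _ = _ := by ring
    · simp_rw [hcc, abs_mul, abs_of_nonneg (sq_nonneg (s N)), ← Finset.mul_sum]
      exact mul_le_mul_of_nonneg_left (hgc N) (sq_nonneg _)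
    · simp_rw [habs, integral_const_mul, ← Finset.mul_sum]
      exact mul_le_mul_of_nonneg_left (hgm N) (by positivity)
  have hσ0 : 0 ≤ σ2 := ge_of_tendsto' hv' fun N => variance_nonneg _ _
  have hdiff : Tendsto (fun N : ℕ => expI P (fun ω => ∑ i ∈ Finset.Icc 1 N, s N * ξ i ω) -
      Complex.exp (-(v N / 2 : ℝ))) atTop (𝓝 0) := by
    rw [tendsto_zero_iff_norm_tendsto_zero, Metric.tendsto_atTop']
    intro e he
    -- The limit of the bound as `N → ∞` is `η σ² + η² σ² ≤ 2 η σ²`.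
    obtain ⟨η, hη, hη1, hηe⟩ : ∃ η : ℝ, 0 < η ∧ η ≤ 1 ∧ η * σ2 + η ^ 2 * σ2 < e := by
      refine ⟨min 1 (e / (2 * σ2 + 1) / 2), by positivity, min_le_left _ _, ?_⟩
      set η := min 1 (e / (2 * σ2 + 1) / 2)
      have h1 : 0 < η := by positivity
      have h2 : η ≤ 1 := min_le_left _ _
      have h3 : η * (2 * σ2 + 1) < e := by
        rw [← lt_div_iff₀ (by positivity)]
        have : 0 < e / (2 * σ2 + 1) := by positivity
        exact (min_le_right _ _).trans_lt (by linarith)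
      have h4 : η ^ 2 * σ2 ≤ η * σ2 := by
        gcongr
        nlinarith
      linarith
    have hlim : Tendsto (fun N => √(T N / m N) + ρ N * W N ^ 2 + (η * (v N + d N) +
        4 * η ^ (-δ) * L N + (η ^ 2 + η ^ (-δ) * L N) * (v N + d N)) + d N) atTop
        (𝓝 (0 + 0 + (η * (σ2 + 0) + 4 * η ^ (-δ) * 0 +
          (η ^ 2 + η ^ (-δ) * 0) * (σ2 + 0)) + 0)) :=
      ((tsq.add tρ).add ((((hv'.add td).const_mul η).add (tL.const_mul _)).add
        (((tL.const_mul _).const_add _).mul (hv'.add td)))).add td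
    obtain ⟨n, hn⟩ := eventually_atTop.1 ((hlim.eventually_lt_const (u := e)
      (by simpa using hηe)).and (eventually_ge_atTop 1))
    refine ⟨n, fun N hN => ?_⟩
    have := hn N hN.le
    rw [dist_zero_right, norm_norm]
    exact (hest η hη hη1 N this.2).trans_lt this.1
  have hexp : Tendsto (fun N : ℕ => Complex.exp (-(v N / 2 : ℝ))) atTop
      (𝓝 (Complex.exp (-(σ2 / 2 : ℝ)))) := by
    have hc : Continuous fun x : ℝ => Complex.exp (-(x / 2 : ℝ)) := by fun_prop
    exact (hc.tendsto σ2).comp hv'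
  have := hdiff.add hexp
  simpa using this

end DoublyStochastic

/-! ### Almost sure growth of sums -/

namespace DoublyStochastic

open scoped ENNReal

/-- Nonnegative random variables with bounded expectations have partial sums `O(N^{1+ε})` almost
surely: the series `∑ F_i / i^{1+ε}` has finite expectation. No independence is needed. -/
lemma ae_exists_sum_le_rpow {Ω : Type*} [MeasurableSpace Ω] {P : Measure Ω} {F : ℕ → Ω → ℝ≥0∞}
    (hF : ∀ i, AEMeasurable (F i) P) {C : ℝ≥0∞} (hC : C ≠ ∞) (hle : ∀ i, ∫⁻ ω, F i ω ∂P ≤ C)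
    {ε : ℝ} (hε : 0 < ε) :
    ∀ᵐ ω ∂P, ∃ K : ℝ, 0 ≤ K ∧
      ∀ N : ℕ, ∑ i ∈ Finset.Icc 1 N, F i ω ≤ ENNReal.ofReal (K * (N : ℝ) ^ (1 + ε)) := by
  have hsum : ∑' i : ℕ, ENNReal.ofReal ((i : ℝ) ^ (-(1 + ε))) ≠ ∞ :=
    (Real.summable_nat_rpow.2 (by linarith)).tsum_ofReal_ne_top
  have hint : ∫⁻ ω, ∑' i : ℕ, ENNReal.ofReal ((i : ℝ) ^ (-(1 + ε))) * F i ω ∂P ≠ ∞ := by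
    rw [lintegral_tsum fun i => (hF i).const_mul _]
    refine ne_top_of_le_ne_top (ENNReal.mul_ne_top hsum hC) ?_
    rw [← ENNReal.tsum_mul_right]
    refine ENNReal.tsum_le_tsum fun i => ?_
    rw [lintegral_const_mul'' _ (hF i)]
    gcongr
    exact hle i
  have hm : AEMeasurable (fun ω => ∑' i : ℕ, ENNReal.ofReal ((i : ℝ) ^ (-(1 + ε))) * F i ω) P :=
    AEMeasurable.tsum fun i => (hF i).const_mul _
  filter_upwards [ae_lt_top' hm hint] with ω hω
  set S := ∑' i : ℕ, ENNReal.ofReal ((i : ℝ) ^ (-(1 + ε))) * F i ω with hS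
  refine ⟨S.toReal, ENNReal.toReal_nonneg, fun N => ?_⟩
  rw [ENNReal.ofReal_mul ENNReal.toReal_nonneg, ENNReal.ofReal_toReal hω.ne]
  calc ∑ i ∈ Finset.Icc 1 N, F i ω
      ≤ ∑ i ∈ Finset.Icc 1 N, ENNReal.ofReal ((i : ℝ) ^ (-(1 + ε))) * F i ω *
          ENNReal.ofReal ((N : ℝ) ^ (1 + ε)) := by
        refine Finset.sum_le_sum fun i hi => ?_
        rw [Finset.mem_Icc] at hi
        have hi0 : (0 : ℝ) < i := by exact_mod_cast hi.1
        have h1 : 1 ≤ ENNReal.ofReal ((i : ℝ) ^ (-(1 + ε))) *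
            ENNReal.ofReal ((N : ℝ) ^ (1 + ε)) := by
          rw [← ENNReal.ofReal_mul (by positivity), ENNReal.one_le_ofReal,
            Real.rpow_neg hi0.le, inv_mul_eq_div, one_le_div (Real.rpow_pos_of_pos hi0 _)]
          exact Real.rpow_le_rpow hi0.le (by exact_mod_cast hi.2) (by linarith)
        calc F i ω = 1 * F i ω := (one_mul _).symm
          _ ≤ (ENNReal.ofReal ((i : ℝ) ^ (-(1 + ε))) * ENNReal.ofReal ((N : ℝ) ^ (1 + ε))) *
              F i ω := by gcongr
          _ = _ := by ring
    _ = (∑ i ∈ Finset.Icc 1 N, ENNReal.ofReal ((i : ℝ) ^ (-(1 + ε))) * F i ω) *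
          ENNReal.ofReal ((N : ℝ) ^ (1 + ε)) := (Finset.sum_mul _ _ _).symm
    _ ≤ S * ENNReal.ofReal ((N : ℝ) ^ (1 + ε)) := by
        gcongr
        exact ENNReal.sum_le_tsum _

variable {s : ℕ} {Ω Ω' : Type*} [MeasurableSpace Ω] [MeasurableSpace Ω']
  {P : Measure Ω} {P' : Measure Ω'} {μ : Measure (EuclideanSpace ℝ (Fin s))}

namespace Model

lemma measurable_elem (M : Model s P P' μ) (i t : ℤ) :
    Measurable fun p : Ω × Ω' => M.elem i t p.1 p.2 := by
  have h : Measurable fun p : Ω × Ω' => (M.y i p.1, fun k => M.ε i k p.2) := by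
    refine ((M.measurable_y i).comp measurable_fst).prodMk (measurable_pi_lambda _ fun k => ?_)
    exact (M.measurable_ε i k).comp measurable_snd
  exact (M.measurable_Z t).comp h

lemma measurable_elem_right (M : Model s P P' μ) (i t : ℤ) (ω : Ω) :
    Measurable (M.elem i t ω) :=
  (M.measurable_elem i t).comp measurable_prodMk_left

/-- Stationarity makes the annealed moments independent of the index `i`. -/
lemma lintegral_elem_eq (M : Model s P P' μ) (hstat : M.IsStationary) {g : ℝ → ℝ≥0∞}
    (hg : Measurable g) (t : ℤ) (i : ℕ) :
    ∫⁻ p, g (M.elem i t p.1 p.2) ∂(P.prod P') = ∫⁻ p, g (M.elem 0 t p.1 p.2) ∂(P.prod P') := by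
  induction i with
  | zero => simp
  | succ i ih =>
    rw [← ih]
    have hm : ∀ c : ℤ, Measurable fun (p : Ω × Ω') (q : ℤ × ℤ) => M.elem (q.1 + c) q.2 p.1 p.2 :=
      fun c => measurable_pi_lambda _ fun q => M.measurable_elem _ _
    have hm0 : Measurable fun (p : Ω × Ω') (q : ℤ × ℤ) => M.elem q.1 q.2 p.1 p.2 :=
      measurable_pi_lambda _ fun q => M.measurable_elem _ _
    have hG : Measurable fun x : ℤ × ℤ → ℝ => g (x ((i : ℤ), t)) :=
      hg.comp (measurable_pi_apply _)
    have h := congrArg (fun ν => ∫⁻ x, g (x ((i : ℤ), t)) ∂ν) hstat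
    rw [lintegral_map hG (hm 1), lintegral_map hG hm0] at h
    exact_mod_cast h

/-- The conditional moments of order `2 + δ` exist and have partial sums `O(N^{1+ε})`. -/
lemma ae_moment_growth [IsProbabilityMeasure P] [IsProbabilityMeasure P'] (M : Model s P P' μ)
    (hstat : M.IsStationary) {δ : ℝ}
    (hK2 : ∀ i t, Integrable (fun p : Ω × Ω' => |M.elem i t p.1 p.2| ^ (2 + δ)) (P.prod P'))
    {ε : ℝ} (hε : 0 < ε) :
    ∀ᵐ ω ∂P, (∀ i t, Integrable (fun ω' => |M.elem i t ω ω'| ^ (2 + δ)) P') ∧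
      ∀ t, ∃ K : ℝ, 0 ≤ K ∧ ∀ N : ℕ, ∑ i ∈ Finset.Icc 1 N,
        ∫ ω', |M.elem i t ω ω'| ^ (2 + δ) ∂P' ≤ K * (N : ℝ) ^ (1 + ε) := by
  have h1 : ∀ᵐ ω ∂P, ∀ i t, Integrable (fun ω' => |M.elem i t ω ω'| ^ (2 + δ)) P' := by
    simp_rw [ae_all_iff]
    exact fun i t => (hK2 i t).prod_right_ae
  have hg : Measurable fun x : ℝ => ENNReal.ofReal (|x| ^ (2 + δ)) :=
    (measurable_id.abs.pow_const _).ennreal_ofReal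
  have hmeas : ∀ i t, Measurable fun p : Ω × Ω' =>
      ENNReal.ofReal (|M.elem i t p.1 p.2| ^ (2 + δ)) := fun i t => hg.comp (M.measurable_elem i t)
  have h2 : ∀ᵐ ω ∂P, ∀ t : ℤ, ∃ K : ℝ, 0 ≤ K ∧ ∀ N : ℕ, ∑ i ∈ Finset.Icc 1 N,
      ∫⁻ ω', ENNReal.ofReal (|M.elem i t ω ω'| ^ (2 + δ)) ∂P' ≤
        ENNReal.ofReal (K * (N : ℝ) ^ (1 + ε)) := by
    rw [ae_all_iff]
    intro t
    refine ae_exists_sum_le_rpow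
      (F := fun i ω => ∫⁻ ω', ENNReal.ofReal (|M.elem i t ω ω'| ^ (2 + δ)) ∂P')
      (fun i => (hmeas i t).lintegral_prod_right'.aemeasurable)
      (C := ∫⁻ p, ENNReal.ofReal (|M.elem 0 t p.1 p.2| ^ (2 + δ)) ∂(P.prod P')) ?_ (fun i => ?_) hε
    · rw [← ofReal_integral_eq_lintegral_ofReal (hK2 0 t)
        (Eventually.of_forall fun p => by positivity)]
      exact ENNReal.ofReal_ne_top
    · rw [← lintegral_prod _ (hmeas i t).aemeasurable]
      exact (M.lintegral_elem_eq hstat hg t i).le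
  filter_upwards [h1, h2] with ω h1 h2
  refine ⟨h1, fun t => ?_⟩
  obtain ⟨K, hK, hN⟩ := h2 t
  refine ⟨K, hK, fun N => ?_⟩
  have hnn : ∀ i : ℤ, 0 ≤ ∫ ω', |M.elem i t ω ω'| ^ (2 + δ) ∂P' := fun i =>
    integral_nonneg fun ω' => by positivity
  have := hN N
  have hconv : ∀ i : ℤ, ∫⁻ ω', ENNReal.ofReal (|M.elem i t ω ω'| ^ (2 + δ)) ∂P' =
      ENNReal.ofReal (∫ ω', |M.elem i t ω ω'| ^ (2 + δ) ∂P') := fun i =>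
    (ofReal_integral_eq_lintegral_ofReal (h1 i t)
      (Eventually.of_forall fun ω' => by positivity)).symm
  simp_rw [hconv] at this
  rw [← ENNReal.ofReal_sum_of_nonneg fun (i : ℕ) _ => hnn i] at this
  exact (ENNReal.ofReal_le_ofReal_iff (by positivity)).1 this

lemma lintegral_control_eq (M : Model s P P' μ) {V : EuclideanSpace ℝ (Fin s) → ℝ}
    (hV : Measurable V) (i : ℤ) :
    ∫⁻ ω, ENNReal.ofReal (V (M.y i ω)) ∂P = ∫⁻ x, ENNReal.ofReal (V x) ∂μ := by
  have h := lintegral_map (μ := P) hV.ennreal_ofReal (M.measurable_y i)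
  rw [M.law_y i] at h
  exact h.symm

/-- The control variables have partial sums `O(N^{1+ε})`. -/
lemma ae_control_growth (M : Model s P P' μ) {V : EuclideanSpace ℝ (Fin s) → ℝ}
    (hV : Measurable V) (hV0 : ∀ x, 0 ≤ V x) (hK5 : Integrable V μ) {ε : ℝ} (hε : 0 < ε) :
    ∀ᵐ ω ∂P, ∃ K : ℝ, 0 ≤ K ∧ ∀ N : ℕ, ∑ i ∈ Finset.Icc 1 N, V (M.y (i : ℕ) ω) ≤
      K * (N : ℝ) ^ (1 + ε) := by
  have h := ae_exists_sum_le_rpow (P := P) (F := fun i ω => ENNReal.ofReal (V (M.y (i : ℕ) ω)))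
    (fun i => ((hV.comp (M.measurable_y i)).ennreal_ofReal).aemeasurable)
    (C := ∫⁻ x, ENNReal.ofReal (V x) ∂μ)
    (by
      rw [← ofReal_integral_eq_lintegral_ofReal hK5 (Eventually.of_forall hV0)]
      exact ENNReal.ofReal_ne_top)
    (fun i => (M.lintegral_control_eq hV i).le) hε
  filter_upwards [h] with ω ⟨K, hK, hN⟩
  refine ⟨K, hK, fun N => ?_⟩
  have := hN N
  rw [← ENNReal.ofReal_sum_of_nonneg fun i _ => hV0 _] at this
  exact (ENNReal.ofReal_le_ofReal_iff (by positivity)).1 this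

/-- The interactions `V(y^i) V(y^j) (j - i)^{-k}` over pairs `i < j` have partial sums
`O(N^{1+ε})`. Independence of `y^i` and `y^j` allows for a control without second moment. -/
lemma ae_pair_growth (M : Model s P P' μ) {V : EuclideanSpace ℝ (Fin s) → ℝ}
    (hV : Measurable V) (hV0 : ∀ x, 0 ≤ V x) (hK5 : Integrable V μ) {k : ℝ} (hk : 1 < k)
    {ε : ℝ} (hε : 0 < ε) :
    ∀ᵐ ω ∂P, ∃ K : ℝ, 0 ≤ K ∧ ∀ N : ℕ, ∑ i ∈ Finset.Icc 1 N, ∑ j ∈ Finset.Icc 1 N with i < j,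
      V (M.y (i : ℕ) ω) * V (M.y (j : ℕ) ω) * ((j - i : ℕ) : ℝ) ^ (-k) ≤
        K * (N : ℝ) ^ (1 + ε) := by
  set m := ∫⁻ x, ENNReal.ofReal (V x) ∂μ with hm
  have hmtop : m ≠ ∞ := by
    rw [hm, ← ofReal_integral_eq_lintegral_ofReal hK5 (Eventually.of_forall hV0)]
    exact ENNReal.ofReal_ne_top
  have hVm : ∀ i : ℤ, Measurable fun ω => ENNReal.ofReal (V (M.y i ω)) := fun i =>
    (hV.comp (M.measurable_y i)).ennreal_ofReal
  have hsum : ∑' r : ℕ, ENNReal.ofReal (((r + 1 : ℕ) : ℝ) ^ (-k)) ≠ ∞ :=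
    ((summable_nat_add_iff 1).2 (Real.summable_nat_rpow.2 (by linarith))).tsum_ofReal_ne_top
  have hterm : ∀ i r : ℕ, Measurable fun ω => ENNReal.ofReal (((r + 1 : ℕ) : ℝ) ^ (-k)) *
      (ENNReal.ofReal (V (M.y (i : ℕ) ω)) * ENNReal.ofReal (V (M.y (i + (r + 1) : ℕ) ω))) :=
    fun i r => ((hVm _).mul (hVm _)).const_mul _
  have h := ae_exists_sum_le_rpow (P := P)
    (F := fun i ω => ∑' r : ℕ, ENNReal.ofReal (((r + 1 : ℕ) : ℝ) ^ (-k)) *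
      (ENNReal.ofReal (V (M.y (i : ℕ) ω)) * ENNReal.ofReal (V (M.y (i + (r + 1) : ℕ) ω))))
    (fun i => (Measurable.tsum fun r => hterm i r).aemeasurable)
    (C := (∑' r : ℕ, ENNReal.ofReal (((r + 1 : ℕ) : ℝ) ^ (-k))) * (m * m))
    (ENNReal.mul_ne_top hsum (ENNReal.mul_ne_top hmtop hmtop))
    (fun i => by
      rw [lintegral_tsum fun r => (hterm i r).aemeasurable, ← ENNReal.tsum_mul_right]
      refine ENNReal.tsum_le_tsum fun r => ?_
      rw [lintegral_const_mul _ ((hVm (i : ℕ)).fun_mul (hVm (i + (r + 1) : ℕ)))]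
      have hne : ((i : ℕ) : ℤ) ≠ ((i + (r + 1) : ℕ) : ℤ) := by
        push_cast
        omega
      have hind : IndepFun (fun ω => ENNReal.ofReal (V (M.y (i : ℕ) ω)))
          (fun ω => ENNReal.ofReal (V (M.y (i + (r + 1) : ℕ) ω))) P :=
        (M.indep_y.indepFun hne).comp hV.ennreal_ofReal hV.ennreal_ofReal
      have := lintegral_mul_eq_lintegral_mul_lintegral_of_indepFun (hVm _) (hVm _) hind
      simp only [Pi.mul_apply] at this
      rw [this, M.lintegral_control_eq hV, M.lintegral_control_eq hV]) hε
  filter_upwards [h] with ω ⟨K, hK, hN⟩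
  refine ⟨K, hK, fun N => ?_⟩
  have hnn : ∀ i j : ℕ, 0 ≤ V (M.y (i : ℕ) ω) * V (M.y (j : ℕ) ω) * ((j - i : ℕ) : ℝ) ^ (-k) :=
    fun i j => mul_nonneg (mul_nonneg (hV0 _) (hV0 _)) (by positivity)
  refine (ENNReal.ofReal_le_ofReal_iff (by positivity)).1 (le_trans ?_ (hN N))
  rw [ENNReal.ofReal_sum_of_nonneg fun i _ => Finset.sum_nonneg fun j _ => hnn i j]
  refine Finset.sum_le_sum fun i _ => ?_
  rw [ENNReal.ofReal_sum_of_nonneg fun j _ => hnn i j]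
  set G : ℕ → ℝ≥0∞ := fun r => ENNReal.ofReal (((r + 1 : ℕ) : ℝ) ^ (-k)) *
    (ENNReal.ofReal (V (M.y (i : ℕ) ω)) * ENNReal.ofReal (V (M.y (i + (r + 1) : ℕ) ω))) with hG
  calc _ = ∑ j ∈ Finset.Icc 1 N with i < j, G (j - i - 1) := by
        refine Finset.sum_congr rfl fun j hj => ?_
        have hij := (Finset.mem_filter.1 hj).2
        have e1 : j - i - 1 + 1 = j - i := by omega
        have e2 : i + (j - i) = j := by omega
        simp only [hG, e1, e2]
        rw [ENNReal.ofReal_mul (mul_nonneg (hV0 _) (hV0 _)), ENNReal.ofReal_mul (hV0 _), mul_comm]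
    _ = ∑ r ∈ (Finset.filter (fun j => i < j) (Finset.Icc 1 N)).image (fun j => j - i - 1),
          G r := by
        refine (Finset.sum_image fun a ha b hb hab => ?_).symm
        have h1 := (Finset.mem_filter.1 ha).2
        have h2 := (Finset.mem_filter.1 hb).2
        omega
    _ ≤ ∑' r, G r := ENNReal.sum_le_tsum _

end Model

end DoublyStochastic

/-! ### Decoupling from weak dependence in a fixed environment -/

namespace DoublyStochastic

/-- Weak dependence of an array `z i t` of random variables, with control variables `v i` and
coefficients `c r`: the inequality of `(κ, Y)`-weak dependence for a frozen environment. -/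
def IsQuenchedDependent {Ω : Type*} [MeasurableSpace Ω] (P : Measure Ω) (z : ℤ → ℤ → Ω → ℝ)
    (v : ℤ → ℝ) (c : ℕ → ℝ) : Prop :=
  ∀ (r u w : ℕ) (i t : Fin u → ℤ) (j t' : Fin w → ℤ),
    Monotone i → Monotone j →
    Function.Injective (fun m => (i m, t m)) → Function.Injective (fun m => (j m, t' m)) →
    (∀ m n, i m + (r : ℤ) < j n) →
    ∀ f ∈ DeltaOne u, ∀ g ∈ Delta w,
      |cov[fun ω => f (fun m => z (i m) (t m) ω), fun ω => g (fun m => z (j m) (t' m) ω); P]| ≤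
        lipConst f * lipConst g * (∑ m, v (i m)) * (∑ m, v (j m)) * c r

lemma lipConst_le {n : ℕ} {f : (Fin n → ℝ) → ℝ} {L : ℝ} (h : IsLip L f) : lipConst f ≤ L :=
  csInf_le ⟨0, fun _ h => h.1⟩ h

lemma lipConst_nonneg {n : ℕ} (f : (Fin n → ℝ) → ℝ) : 0 ≤ lipConst f :=
  Real.sInf_nonneg fun _ h => h.1

/-- A finite set of pairs listed without repetition, first coordinates in nondecreasing order. -/
lemma exists_enumeration (A : Finset (ℤ × ℤ)) :
    ∃ e : Fin A.card → ℤ × ℤ, Monotone (fun m => (e m).1) ∧ Function.Injective e ∧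
      (∀ m, e m ∈ A) ∧ ∀ F : ℤ × ℤ → ℝ, ∑ m, F (e m) = ∑ p ∈ A, F p := by
  set A' : Finset (ℤ ×ₗ ℤ) := A.map toLex.toEmbedding with hA'
  have hc : A'.card = A.card := Finset.card_map _
  set o := A'.orderEmbOfFin hc with ho
  have hmem : ∀ m, ofLex (o m) ∈ A := fun m => by
    have := A'.orderEmbOfFin_mem hc m
    simp only [hA', Finset.mem_map, Equiv.coe_toEmbedding] at this
    obtain ⟨p, hp, hpe⟩ := this
    rw [ho, ← hpe]
    exact hp
  refine ⟨fun m => ofLex (o m), fun a b hab => ?_, fun a b hab => ?_, hmem, fun F => ?_⟩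
  · exact Prod.Lex.monotone_fst _ _ (o.monotone hab)
  · exact o.injective (ofLex.injective hab)
  · have h1 : ∑ x ∈ A', F (ofLex x) = ∑ p ∈ A, F p := by
      rw [hA', Finset.sum_map]
      rfl
    rw [← h1, ← Finset.map_orderEmbOfFin_univ A' hc, Finset.sum_map]
    rfl

lemma isLip_comp_linear {n : ℕ} {φ : ℝ → ℝ} (hφ : ∀ x y, |φ x - φ y| ≤ |x - y|) {a : Fin n → ℝ}
    {L : ℝ} (hL : 0 ≤ L) (ha : ∀ m, |a m| ≤ L) : IsLip L fun x => φ (∑ m, a m * x m) := by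
  refine ⟨hL, fun x y => (hφ _ _).trans ?_⟩
  rw [← Finset.sum_sub_distrib, Finset.mul_sum]
  refine (Finset.abs_sum_le_sum_abs _ _).trans (Finset.sum_le_sum fun m _ => ?_)
  rw [← mul_sub, abs_mul]
  gcongr
  exact ha m

/-- Weak dependence tested on bounded `1`-Lipschitz functions of linear combinations. -/
lemma IsQuenchedDependent.abs_cov_comp_linear_le {Ω : Type*} [MeasurableSpace Ω] {P : Measure Ω}
    {z : ℤ → ℤ → Ω → ℝ} {v : ℤ → ℝ} {c : ℕ → ℝ} (h : IsQuenchedDependent P z v c)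
    (hv : ∀ i, 0 ≤ v i) {φ ψ : ℝ → ℝ} (hφ1 : ∀ x, |φ x| ≤ 1)
    (hφ : ∀ x y, |φ x - φ y| ≤ |x - y|) (hψ1 : ∀ x, |ψ x| ≤ 1)
    (hψ : ∀ x y, |ψ x - ψ y| ≤ |x - y|) (A B : Finset (ℤ × ℤ)) {r : ℕ} (hc : 0 ≤ c r)
    (hsep : ∀ p ∈ A, ∀ q ∈ B, p.1 + (r : ℤ) < q.1) {a : ℤ × ℤ → ℝ} {L : ℝ} (hL : 0 ≤ L)
    (ha : ∀ p ∈ A, |a p| ≤ L) (hb : ∀ p ∈ B, |a p| ≤ L) :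
    |cov[fun ω => φ (∑ p ∈ A, a p * z p.1 p.2 ω), fun ω => ψ (∑ p ∈ B, a p * z p.1 p.2 ω); P]| ≤
      L * L * (∑ p ∈ A, v p.1) * (∑ p ∈ B, v p.1) * c r := by
  obtain ⟨e, he, hei, hem, hes⟩ := exists_enumeration A
  obtain ⟨e', he', hei', hem', hes'⟩ := exists_enumeration B
  have lf := isLip_comp_linear hφ hL fun m => ha (e m) (hem m)
  have lg := isLip_comp_linear hψ hL fun m => hb (e' m) (hem' m)
  have := h r _ _ (fun m => (e m).1) (fun m => (e m).2) (fun m => (e' m).1) (fun m => (e' m).2)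
    he he' hei hei' (fun m n => hsep _ (hem m) _ (hem' n))
    (fun x => φ (∑ m, a (e m) * x m)) ⟨⟨⟨1, fun x => hφ1 _⟩, L, lf⟩, fun x => hφ1 _⟩
    (fun x => ψ (∑ m, a (e' m) * x m)) ⟨⟨1, fun x => hψ1 _⟩, L, lg⟩
  have e1 : ∀ ω, ∑ m, a (e m) * z (e m).1 (e m).2 ω = ∑ p ∈ A, a p * z p.1 p.2 ω := fun ω =>
    hes fun p => a p * z p.1 p.2 ω
  have e2 : ∀ ω, ∑ m, a (e' m) * z (e' m).1 (e' m).2 ω = ∑ p ∈ B, a p * z p.1 p.2 ω := fun ω =>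
    hes' fun p => a p * z p.1 p.2 ω
  simp only [e1, e2] at this
  rw [hes fun p => v p.1, hes' fun p => v p.1] at this
  refine this.trans ?_
  have h1 : 0 ≤ ∑ p ∈ A, v p.1 := Finset.sum_nonneg fun p _ => hv _
  have h2 : 0 ≤ ∑ p ∈ B, v p.1 := Finset.sum_nonneg fun p _ => hv _
  gcongr
  · exact lipConst_nonneg _
  · exact lipConst_le lf
  · exact lipConst_le lg

/-- The decoupling error of `𝔼 e^{i(U + W)}` in terms of the covariances of the real and
imaginary parts. -/
lemma norm_expI_add_sub_mul_le {Ω : Type*} [MeasurableSpace Ω] {P : Measure Ω}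
    [IsProbabilityMeasure P] {U W : Ω → ℝ} (hU : Measurable U) (hW : Measurable W) {e : ℝ}
    (h1 : |cov[fun ω => Real.cos (U ω), fun ω => Real.cos (W ω); P]| ≤ e)
    (h2 : |cov[fun ω => Real.sin (U ω), fun ω => Real.sin (W ω); P]| ≤ e)
    (h3 : |cov[fun ω => Real.cos (U ω), fun ω => Real.sin (W ω); P]| ≤ e)
    (h4 : |cov[fun ω => Real.sin (U ω), fun ω => Real.cos (W ω); P]| ≤ e) :
    ‖expI P (fun ω => U ω + W ω) - expI P U * expI P W‖ ≤ 4 * e := by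
  have lc : ∀ {X : Ω → ℝ}, Measurable X → MemLp (fun ω => Real.cos (X ω)) 2 P := fun hX =>
    MemLp.of_bound (Real.measurable_cos.comp hX).aestronglyMeasurable 1
      (Eventually.of_forall fun ω => by simpa using Real.abs_cos_le_one _)
  have ls : ∀ {X : Ω → ℝ}, Measurable X → MemLp (fun ω => Real.sin (X ω)) 2 P := fun hX =>
    MemLp.of_bound (Real.measurable_sin.comp hX).aestronglyMeasurable 1
      (Eventually.of_forall fun ω => by simpa using Real.abs_sin_le_one _)
  have hexp : ∀ {X : Ω → ℝ}, Measurable X → expI P X =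
      (∫ ω, Real.cos (X ω) ∂P : ℝ) + (∫ ω, Real.sin (X ω) ∂P : ℝ) * Complex.I := by
    intro X hX
    have i1 : Integrable (fun ω => ((Real.cos (X ω) : ℝ) : ℂ)) P :=
      ((lc hX).integrable one_le_two).ofReal
    have i2 : Integrable (fun ω => ((Real.sin (X ω) : ℝ) : ℂ) * Complex.I) P :=
      (((ls hX).integrable one_le_two).ofReal (𝕜 := ℂ)).mul_const _
    rw [expI, ← integral_complex_ofReal, ← integral_complex_ofReal, ← integral_mul_const,
      ← integral_add i1 i2]
    refine integral_congr_ae (Eventually.of_forall fun ω => ?_)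
    simp [Complex.exp_mul_I]
  have hmul : ∀ {F G : Ω → ℝ}, MemLp F 2 P → MemLp G 2 P →
      ∫ ω, F ω * G ω ∂P = cov[F, G; P] + (∫ ω, F ω ∂P) * ∫ ω, G ω ∂P := by
    intro F G hF hG
    rw [covariance_eq_sub hF hG]
    simp
  have hi : ∀ {F G : Ω → ℝ}, MemLp F 2 P → MemLp G 2 P → Integrable (fun ω => F ω * G ω) P :=
    fun hF hG => hF.integrable_mul hG
  rw [hexp (hU.fun_add hW), hexp hU, hexp hW]
  have c1 : ∫ ω, Real.cos (U ω + W ω) ∂P = (cov[fun ω => Real.cos (U ω), fun ω => Real.cos (W ω); P]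
      + (∫ ω, Real.cos (U ω) ∂P) * ∫ ω, Real.cos (W ω) ∂P) -
      (cov[fun ω => Real.sin (U ω), fun ω => Real.sin (W ω); P]
      + (∫ ω, Real.sin (U ω) ∂P) * ∫ ω, Real.sin (W ω) ∂P) := by
    simp_rw [Real.cos_add]
    rw [integral_sub (hi (lc hU) (lc hW)) (hi (ls hU) (ls hW)), hmul (lc hU) (lc hW),
      hmul (ls hU) (ls hW)]
  have c2 : ∫ ω, Real.sin (U ω + W ω) ∂P = (cov[fun ω => Real.sin (U ω), fun ω => Real.cos (W ω); P]
      + (∫ ω, Real.sin (U ω) ∂P) * ∫ ω, Real.cos (W ω) ∂P) +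
      (cov[fun ω => Real.cos (U ω), fun ω => Real.sin (W ω); P]
      + (∫ ω, Real.cos (U ω) ∂P) * ∫ ω, Real.sin (W ω) ∂P) := by
    simp_rw [Real.sin_add]
    rw [integral_add (hi (ls hU) (lc hW)) (hi (lc hU) (ls hW)), hmul (ls hU) (lc hW),
      hmul (lc hU) (ls hW)]
  rw [c1, c2]
  set x1 := cov[fun ω => Real.cos (U ω), fun ω => Real.cos (W ω); P]
  set x2 := cov[fun ω => Real.sin (U ω), fun ω => Real.sin (W ω); P]
  set x3 := cov[fun ω => Real.cos (U ω), fun ω => Real.sin (W ω); P]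
  set x4 := cov[fun ω => Real.sin (U ω), fun ω => Real.cos (W ω); P]
  have key : ∀ p q p' q' : ℝ, (((x1 + p * p') - (x2 + q * q') : ℝ) : ℂ) +
      (((x4 + q * p') + (x3 + p * q') : ℝ) : ℂ) * Complex.I -
      ((p : ℂ) + q * Complex.I) * ((p' : ℂ) + q' * Complex.I) =
      ((x1 - x2 : ℝ) : ℂ) + ((x4 + x3 : ℝ) : ℂ) * Complex.I := by
    intro p q p' q'
    push_cast
    linear_combination (-(q : ℂ) * q') * Complex.I_sq
  rw [key]
  refine (norm_add_le _ _).trans ?_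
  rw [norm_mul, Complex.norm_I, mul_one, Complex.norm_real, Complex.norm_real,
    Real.norm_eq_abs, Real.norm_eq_abs]
  have := abs_sub x1 x2
  have := abs_add_le x4 x3
  linarith

/-- Truncation at level `R`, rescaled to the unit interval, tested against the covariance: if the
covariances of all truncations obey a common bound, so does the covariance. -/
lemma abs_cov_le_of_truncation {Ω : Type*} [MeasurableSpace Ω] {P : Measure Ω}
    [IsProbabilityMeasure P] {U W : Ω → ℝ} (hU : MemLp U 2 P) (hW : MemLp W 2 P) {e : ℝ}
    (h : ∀ R : ℕ, 0 < R → |cov[fun ω => max (-1) (min 1 ((R : ℝ)⁻¹ * U ω)),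
      fun ω => max (-1) (min 1 ((R : ℝ)⁻¹ * W ω)); P]| ≤ ((R : ℝ)⁻¹) ^ 2 * e) :
    |cov[U, W; P]| ≤ e := by
  set τ : ℕ → ℝ → ℝ := fun R x => R * max (-1) (min 1 ((R : ℝ)⁻¹ * x)) with hτ
  have hτc : ∀ R, Continuous (τ R) := fun R => by
    simp only [hτ]
    fun_prop
  have hτb : ∀ R x, |τ R x| ≤ |x| := by
    intro R x
    rcases Nat.eq_zero_or_pos R with rfl | hR
    · simp [hτ]
    · have hR' : (0 : ℝ) < R := by exact_mod_cast hR
      simp only [hτ]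
      rw [abs_mul, abs_of_pos hR']
      have : |max (-1) (min 1 ((R : ℝ)⁻¹ * x))| ≤ |(R : ℝ)⁻¹ * x| := by
        rw [abs_le]
        have h1 := neg_abs_le ((R : ℝ)⁻¹ * x)
        have h2 := le_abs_self ((R : ℝ)⁻¹ * x)
        have h3 := abs_nonneg ((R : ℝ)⁻¹ * x)
        constructor
        · refine le_max_of_le_right (le_min (by linarith) h1)
        · exact max_le (by linarith) ((min_le_right _ _).trans h2)
      calc (R : ℝ) * _ ≤ R * |(R : ℝ)⁻¹ * x| := by gcongr
        _ = |x| := by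
            rw [abs_mul, abs_of_pos (inv_pos.2 hR'), ← mul_assoc, mul_inv_cancel₀ hR'.ne', one_mul]
  have hτl : ∀ x, Tendsto (fun R => τ R x) atTop (𝓝 x) := by
    intro x
    refine tendsto_const_nhds.congr' ?_
    obtain ⟨n, hn⟩ := exists_nat_ge |x|
    filter_upwards [eventually_ge_atTop (max n 1)] with R hR
    have hR0 : (0 : ℝ) < R := by exact_mod_cast (le_max_right _ _).trans hR
    have hR1 : |x| ≤ R := hn.trans (by exact_mod_cast (le_max_left _ _).trans hR)
    have h1 := abs_le.1 hR1
    have h2 : (R : ℝ)⁻¹ * x ≤ 1 := by rw [inv_mul_le_iff₀ hR0]; linarith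
    have h3 : -1 ≤ (R : ℝ)⁻¹ * x := by rw [le_inv_mul_iff₀ hR0]; linarith
    simp only [hτ]
    rw [min_eq_right h2, max_eq_right h3, mul_inv_cancel_left₀ hR0.ne']
  have hL : ∀ {X : Ω → ℝ}, MemLp X 2 P → ∀ R, MemLp (fun ω => τ R (X ω)) 2 P := fun hX R =>
    hX.of_le ((hτc R).comp_aestronglyMeasurable hX.aestronglyMeasurable)
      (Eventually.of_forall fun ω => by simpa using hτb R _)
  have hI : ∀ {X : Ω → ℝ}, MemLp X 2 P →
      Tendsto (fun R => ∫ ω, τ R (X ω) ∂P) atTop (𝓝 (∫ ω, X ω ∂P)) := fun hX =>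
    tendsto_integral_of_dominated_convergence _ (fun R => (hL hX R).aestronglyMeasurable)
      (hX.integrable one_le_two).norm
      (fun R => Eventually.of_forall fun ω => by simpa using hτb R _)
      (Eventually.of_forall fun ω => hτl _)
  have hII : Tendsto (fun R => ∫ ω, τ R (U ω) * τ R (W ω) ∂P) atTop (𝓝 (∫ ω, U ω * W ω ∂P)) :=
    tendsto_integral_of_dominated_convergence (fun ω => ‖U ω * W ω‖)
      (fun R => (hL hU R).aestronglyMeasurable.mul (hL hW R).aestronglyMeasurable)
      (hU.integrable_mul hW).norm
      (fun R => Eventually.of_forall fun ω => by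
        rw [Real.norm_eq_abs, Real.norm_eq_abs, abs_mul (τ R (U ω)), abs_mul (U ω)]
        exact mul_le_mul (hτb R _) (hτb R _) (abs_nonneg _) (abs_nonneg _))
      (Eventually.of_forall fun ω => (hτl _).mul (hτl _))
  have hlim : Tendsto (fun R => cov[fun ω => τ R (U ω), fun ω => τ R (W ω); P]) atTop
      (𝓝 cov[U, W; P]) := by
    rw [covariance_eq_sub hU hW]
    refine Tendsto.congr (fun R => (covariance_eq_sub (hL hU R) (hL hW R)).symm) ?_
    exact hII.sub ((hI hU).mul (hI hW))
  refine le_of_tendsto hlim.abs ?_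
  filter_upwards [eventually_gt_atTop 0] with R hR
  have hR0 : (0 : ℝ) < R := by exact_mod_cast hR
  simp only [hτ]
  rw [covariance_const_mul_left, covariance_const_mul_right, ← mul_assoc, abs_mul,
    abs_of_nonneg (by positivity)]
  calc (R : ℝ) * R * _ ≤ R * R * (((R : ℝ)⁻¹) ^ 2 * e) := by
        gcongr
        exact h R hR
    _ = e := by field_simp

end DoublyStochastic

/-! ### The central limit theorem in a fixed environment -/

namespace DoublyStochastic

/-- The pairs `(i, t)` with `i ∈ A` and `t ∈ T`. -/
def pairSet (A : Finset ℕ) (T : Finset ℤ) : Finset (ℤ × ℤ) :=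
  (A.map Nat.castEmbedding) ×ˢ T

lemma sum_pairSet (A : Finset ℕ) (T : Finset ℤ) (F : ℤ × ℤ → ℝ) :
    ∑ p ∈ pairSet A T, F p = ∑ i ∈ A, ∑ t ∈ T, F ((i : ℤ), t) := by
  rw [pairSet, Finset.sum_product, Finset.sum_map]
  rfl

lemma mem_pairSet {A : Finset ℕ} {T : Finset ℤ} {p : ℤ × ℤ} (hp : p ∈ pairSet A T) :
    (∃ i ∈ A, (i : ℤ) = p.1) ∧ p.2 ∈ T := by
  rw [pairSet, Finset.mem_product, Finset.mem_map] at hp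
  exact hp

lemma abs_clip_le_one (x : ℝ) : |max (-1) (min 1 x)| ≤ 1 :=
  abs_le.2 ⟨le_max_left _ _, max_le (by norm_num) (min_le_left _ _)⟩

lemma abs_clip_sub_clip_le (x y : ℝ) :
    |max (-1) (min 1 x) - max (-1) (min 1 y)| ≤ |x - y| := by
  refine (abs_max_sub_max_le_max _ _ _ _).trans (max_le (by simp) ?_)
  exact (abs_min_sub_min_le_max _ _ _ _).trans (max_le (by simp) le_rfl)

section

variable {Ω : Type*} [MeasurableSpace Ω] {P : Measure Ω} [IsProbabilityMeasure P]
  {z : ℤ → ℤ → Ω → ℝ} {v : ℤ → ℝ} {c : ℕ → ℝ}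

/-- Characteristic functions of weighted sums over separated index sets decouple. -/
lemma IsQuenchedDependent.norm_expI_sub_mul_le (h : IsQuenchedDependent P z v c)
    (hz : ∀ i t, Measurable (z i t)) (hv : ∀ i, 0 ≤ v i) {r : ℕ} (hc : 0 ≤ c r)
    (T : Finset ℤ) (a : ℤ → ℝ) (s : ℝ) (A B : Finset ℕ) (hsep : ∀ i ∈ A, ∀ j ∈ B, i + r < j) :
    ‖expI P (fun ω => ∑ i ∈ A, s * ∑ t ∈ T, a t * z i t ω +
        ∑ i ∈ B, s * ∑ t ∈ T, a t * z i t ω) -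
      expI P (fun ω => ∑ i ∈ A, s * ∑ t ∈ T, a t * z i t ω) *
        expI P (fun ω => ∑ i ∈ B, s * ∑ t ∈ T, a t * z i t ω)‖ ≤
      4 * (∑ t ∈ T, |a t|) ^ 2 * (T.card : ℝ) ^ 2 * s ^ 2 * c r *
        (∑ i ∈ A, v i) * ∑ i ∈ B, v i := by
  have hsum : ∀ (A : Finset ℕ) (ω : Ω), ∑ i ∈ A, s * ∑ t ∈ T, a t * z i t ω =
      ∑ p ∈ pairSet A T, (s * a p.2) * z p.1 p.2 ω := fun A ω => by
    rw [sum_pairSet]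
    simp only [Finset.mul_sum, mul_assoc]
  have hvs : ∀ A : Finset ℕ, ∑ p ∈ pairSet A T, v p.1 = T.card * ∑ i ∈ A, v i := fun A => by
    rw [sum_pairSet]
    simp [Finset.mul_sum]
  have hms : ∀ A : Finset ℕ,
      Measurable fun ω => ∑ p ∈ pairSet A T, (s * a p.2) * z p.1 p.2 ω := fun A =>
    Finset.measurable_fun_sum _ fun p _ => (hz _ _).const_mul _
  have hL : 0 ≤ |s| * ∑ t ∈ T, |a t| := by positivity
  have ha : ∀ A : Finset ℕ, ∀ p ∈ pairSet A T, |s * a p.2| ≤ |s| * ∑ t ∈ T, |a t| := by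
    intro A p hp
    rw [abs_mul]
    gcongr
    exact Finset.single_le_sum (f := fun t => |a t|) (fun t _ => abs_nonneg _) (mem_pairSet hp).2
  have hsep' : ∀ p ∈ pairSet A T, ∀ q ∈ pairSet B T, p.1 + (r : ℤ) < q.1 := by
    intro p hp q hq
    obtain ⟨⟨i, hi, hip⟩, -⟩ := mem_pairSet hp
    obtain ⟨⟨j, hj, hjq⟩, -⟩ := mem_pairSet hq
    rw [← hip, ← hjq]
    exact_mod_cast hsep i hi j hj
  simp_rw [hsum]
  have key := fun (φ ψ : ℝ → ℝ) h1 h2 h3 h4 => h.abs_cov_comp_linear_le hv (φ := φ) (ψ := ψ)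
    h1 h2 h3 h4 (pairSet A T) (pairSet B T) hc hsep' hL (ha A) (ha B)
  refine (norm_expI_add_sub_mul_le (hms A) (hms B)
    (key Real.cos Real.cos Real.abs_cos_le_one Real.abs_cos_sub_cos_le Real.abs_cos_le_one
      Real.abs_cos_sub_cos_le)
    (key Real.sin Real.sin Real.abs_sin_le_one Real.abs_sin_sub_sin_le Real.abs_sin_le_one
      Real.abs_sin_sub_sin_le)
    (key Real.cos Real.sin Real.abs_cos_le_one Real.abs_cos_sub_cos_le Real.abs_sin_le_one
      Real.abs_sin_sub_sin_le)
    (key Real.sin Real.cos Real.abs_sin_le_one Real.abs_sin_sub_sin_le Real.abs_cos_le_one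
      Real.abs_cos_sub_cos_le)).trans (le_of_eq ?_)
  rw [hvs, hvs, ← sq_abs s]
  ring

/-- The covariance inequality for the weighted sums `∑_t a_t z^i_t` themselves: the truncations at
level `R` have Lipschitz constants of order `1 / R`, and the factor `R²` cancels. -/
lemma IsQuenchedDependent.abs_cov_sum_le (h : IsQuenchedDependent P z v c)
    (hz2 : ∀ i t, MemLp (z i t) 2 P) (hv : ∀ i, 0 ≤ v i) {r : ℕ} (hc : 0 ≤ c r)
    (T : Finset ℤ) (a : ℤ → ℝ) {i j : ℕ} (hij : i + r < j) :
    |cov[fun ω => ∑ t ∈ T, a t * z i t ω, fun ω => ∑ t ∈ T, a t * z j t ω; P]| ≤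
      (∑ t ∈ T, |a t|) ^ 2 * (T.card : ℝ) ^ 2 * c r * v i * v j := by
  have hLp : ∀ i : ℤ, MemLp (fun ω => ∑ t ∈ T, a t * z i t ω) 2 P := fun i =>
    memLp_finsetSum _ fun t _ => (hz2 i t).const_mul _
  refine abs_cov_le_of_truncation (hLp i) (hLp j) fun R hR => ?_
  have hR0 : (0 : ℝ) < (R : ℝ)⁻¹ := inv_pos.2 (by exact_mod_cast hR)
  have hsum : ∀ (i : ℕ) (ω : Ω), (R : ℝ)⁻¹ * ∑ t ∈ T, a t * z i t ω =
      ∑ p ∈ pairSet {i} T, ((R : ℝ)⁻¹ * a p.2) * z p.1 p.2 ω := fun i ω => by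
    rw [sum_pairSet, Finset.sum_singleton, Finset.mul_sum]
    simp only [mul_assoc]
  have hvs : ∀ i : ℕ, ∑ p ∈ pairSet {i} T, v p.1 = T.card * v i := fun i => by
    rw [sum_pairSet]
    simp
  have hL : 0 ≤ (R : ℝ)⁻¹ * ∑ t ∈ T, |a t| := by positivity
  have ha : ∀ i : ℕ, ∀ p ∈ pairSet {i} T, |(R : ℝ)⁻¹ * a p.2| ≤ (R : ℝ)⁻¹ * ∑ t ∈ T, |a t| := by
    intro i p hp
    rw [abs_mul, abs_of_pos hR0]
    gcongr
    exact Finset.single_le_sum (f := fun t => |a t|) (fun t _ => abs_nonneg _) (mem_pairSet hp).2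
  have hsep' : ∀ p ∈ pairSet {i} T, ∀ q ∈ pairSet {j} T, p.1 + (r : ℤ) < q.1 := by
    intro p hp q hq
    obtain ⟨⟨i', hi, hip⟩, -⟩ := mem_pairSet hp
    obtain ⟨⟨j', hj, hjq⟩, -⟩ := mem_pairSet hq
    rw [Finset.mem_singleton] at hi hj
    rw [← hip, ← hjq, hi, hj]
    exact_mod_cast hij
  simp_rw [hsum]
  refine (h.abs_cov_comp_linear_le hv abs_clip_le_one abs_clip_sub_clip_le abs_clip_le_one
    abs_clip_sub_clip_le _ _ hc hsep' hL (ha i) (ha j)).trans (le_of_eq ?_)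
  rw [hvs, hvs]
  ring

/-- In a fixed environment, finite linear combinations of the aggregates satisfy the central
limit theorem. -/
theorem IsQuenchedDependent.tendsto_expI (h : IsQuenchedDependent P z v c)
    (hz : ∀ i t, Measurable (z i t)) (hz2 : ∀ i t, MemLp (z i t) 2 P)
    (hz0 : ∀ i t, ∫ ω, z i t ω ∂P = 0) (hv : ∀ i, 0 ≤ v i) {δ k Cκ : ℝ} (hδ : 0 < δ) (hk : 0 ≤ k)
    (hzδ : ∀ i t, Integrable (fun ω => |z i t ω| ^ (2 + δ)) P)
    (hc : ∀ r, 0 ≤ c r) (hCκ : 0 ≤ Cκ) (hcle : ∀ r, c r ≤ Cκ * ((r : ℝ) + 1) ^ (-k))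
    {β ε : ℝ} (hε : 0 < ε) (hβ0 : 0 ≤ β) (hβ : 1 + 2 * ε < k * β)
    (hβ' : (1 + δ) * (β + 2 * ε) + ε < δ / 2)
    (hgm : ∀ t, ∃ K : ℝ, 0 ≤ K ∧ ∀ N : ℕ, ∑ i ∈ Finset.Icc 1 N, ∫ ω, |z i t ω| ^ (2 + δ) ∂P ≤
      K * (N : ℝ) ^ (1 + ε))
    (hgv : ∃ K : ℝ, 0 ≤ K ∧ ∀ N : ℕ, ∑ i ∈ Finset.Icc 1 N, v (i : ℕ) ≤ K * (N : ℝ) ^ (1 + ε))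
    (hgp : ∃ K : ℝ, 0 ≤ K ∧ ∀ N : ℕ, ∑ i ∈ Finset.Icc 1 N, ∑ j ∈ Finset.Icc 1 N with i < j,
      v (i : ℕ) * v (j : ℕ) * ((j - i : ℕ) : ℝ) ^ (-k) ≤ K * (N : ℝ) ^ (1 + ε))
    {Γ : ℤ → ℝ} (hΓ : ∀ t τ, Tendsto (fun N : ℕ =>
      cov[fun ω => (√N)⁻¹ * ∑ i ∈ Finset.Icc 1 N, z (i : ℕ) t ω,
        fun ω => (√N)⁻¹ * ∑ i ∈ Finset.Icc 1 N, z (i : ℕ) (t + τ) ω; P]) atTop (𝓝 (Γ τ)))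
    (T : Finset ℤ) (a : ℤ → ℝ) :
    Tendsto (fun N : ℕ => Var[fun ω => ∑ t ∈ T, a t * ((√N)⁻¹ *
        ∑ i ∈ Finset.Icc 1 N, z (i : ℕ) t ω); P]) atTop
      (𝓝 (∑ t ∈ T, ∑ u ∈ T, a t * a u * Γ (u - t))) ∧
    Tendsto (fun N : ℕ => expI P fun ω => ∑ t ∈ T, a t * ((√N)⁻¹ *
        ∑ i ∈ Finset.Icc 1 N, z (i : ℕ) t ω)) atTop
      (𝓝 (Complex.exp (-((∑ t ∈ T, ∑ u ∈ T, a t * a u * Γ (u - t)) / 2 : ℝ)))) := by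
  set ξ : ℕ → Ω → ℝ := fun i ω => ∑ t ∈ T, a t * z i t ω with hξdef
  set q := ∑ t ∈ T, ∑ u ∈ T, a t * a u * Γ (u - t) with hq
  have hswap : ∀ (N : ℕ) (ω : Ω), ∑ t ∈ T, a t * ((√N)⁻¹ * ∑ i ∈ Finset.Icc 1 N, z (i : ℕ) t ω) =
      ∑ i ∈ Finset.Icc 1 N, (√N)⁻¹ * ξ i ω := by
    intro N ω
    simp only [hξdef, Finset.mul_sum]
    rw [Finset.sum_comm]
    exact Finset.sum_congr rfl fun i _ => Finset.sum_congr rfl fun t _ => by ring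
  have hagg : ∀ (N : ℕ) (t : ℤ),
      MemLp (fun ω => (√N)⁻¹ * ∑ i ∈ Finset.Icc 1 N, z (i : ℕ) t ω) 2 P := fun N t =>
    (memLp_finsetSum (Finset.Icc 1 N) fun (i : ℕ) _ => hz2 i t).const_mul _
  have hvar : Tendsto (fun N : ℕ => Var[fun ω => ∑ t ∈ T, a t * ((√N)⁻¹ *
        ∑ i ∈ Finset.Icc 1 N, z (i : ℕ) t ω); P]) atTop (𝓝 q) := by
    have e : ∀ N : ℕ, Var[fun ω => ∑ t ∈ T, a t * ((√N)⁻¹ *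
        ∑ i ∈ Finset.Icc 1 N, z (i : ℕ) t ω); P] = ∑ t ∈ T, ∑ u ∈ T, a t * a u *
        cov[fun ω => (√N)⁻¹ * ∑ i ∈ Finset.Icc 1 N, z (i : ℕ) t ω,
          fun ω => (√N)⁻¹ * ∑ i ∈ Finset.Icc 1 N, z (i : ℕ) (t + (u - t)) ω; P] := by
      intro N
      have hL : ∀ t ∈ T,
          MemLp (fun ω => a t * ((√N)⁻¹ * ∑ i ∈ Finset.Icc 1 N, z (i : ℕ) t ω)) 2 P := fun t _ =>
        (hagg N t).const_mul _
      rw [← covariance_self (memLp_finsetSum _ hL).aestronglyMeasurable.aemeasurable,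
        covariance_fun_sum_fun_sum' hL hL]
      refine Finset.sum_congr rfl fun t _ => Finset.sum_congr rfl fun u _ => ?_
      rw [covariance_const_mul_left (a t), covariance_const_mul_right (a u), add_sub_cancel]
      ring
    simp_rw [e]
    exact tendsto_finsetSum _ fun t _ => tendsto_finsetSum _ fun u _ =>
      (hΓ t (u - t)).const_mul _
  refine ⟨hvar, ?_⟩
  have hξ2 : ∀ i, MemLp (ξ i) 2 P := fun i => memLp_finsetSum _ fun t _ => (hz2 i t).const_mul _
  have hξ0 : ∀ i, ∫ ω, ξ i ω ∂P = 0 := fun i => by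
    simp only [hξdef]
    rw [integral_finsetSum _ fun t _ => ((hz2 i t).integrable one_le_two).const_mul _]
    exact Finset.sum_eq_zero fun t _ => by rw [integral_const_mul, hz0, mul_zero]
  have habs : ∀ i t ω, |a t * z i t ω| ^ (2 + δ) = |a t| ^ (2 + δ) * |z i t ω| ^ (2 + δ) :=
    fun i t ω => by rw [abs_mul, Real.mul_rpow (abs_nonneg _) (abs_nonneg _)]
  have hξδ : ∀ i : ℕ, Integrable (fun ω => |ξ i ω| ^ (2 + δ)) P ∧
      ∫ ω, |ξ i ω| ^ (2 + δ) ∂P ≤ (T.card : ℝ) ^ (1 + δ) *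
        ∑ t ∈ T, |a t| ^ (2 + δ) * ∫ ω, |z i t ω| ^ (2 + δ) ∂P := fun i => by
    have := integral_abs_sum_rpow_le (P := P) (X := fun t ω => a t * z i t ω)
      (by linarith : (1 : ℝ) ≤ 2 + δ) (fun t => ((hz i t).const_mul _).aestronglyMeasurable)
      (fun t => by
        simp_rw [habs]
        exact (hzδ i t).const_mul _) T le_rfl
    simp_rw [habs, integral_const_mul] at this
    rwa [show 2 + δ - 1 = 1 + δ by ring] at this
  set D := 4 * (∑ t ∈ T, |a t|) ^ 2 * (T.card : ℝ) ^ 2 * Cκ with hD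
  have hD0 : 0 ≤ D := by positivity
  have hfac : ∀ (s : ℝ) (r : ℕ) (A B : Finset ℕ), (∀ i ∈ A, ∀ j ∈ B, i + r < j) →
      ‖expI P (fun ω => ∑ i ∈ A, s * ξ i ω + ∑ i ∈ B, s * ξ i ω) -
        expI P (fun ω => ∑ i ∈ A, s * ξ i ω) * expI P (fun ω => ∑ i ∈ B, s * ξ i ω)‖ ≤
        D * s ^ 2 * ((r : ℝ) + 1) ^ (-k) * (∑ i ∈ A, v (i : ℕ)) * ∑ i ∈ B, v (i : ℕ) := by
    intro s r A B hAB
    refine (h.norm_expI_sub_mul_le hz hv (hc r) T a s A B hAB).trans ?_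
    have h1 : 0 ≤ ∑ i ∈ A, v (i : ℕ) := Finset.sum_nonneg fun i _ => hv _
    have h2 : 0 ≤ ∑ i ∈ B, v (i : ℕ) := Finset.sum_nonneg fun i _ => hv _
    calc _ ≤ 4 * (∑ t ∈ T, |a t|) ^ 2 * (T.card : ℝ) ^ 2 * s ^ 2 *
          (Cκ * ((r : ℝ) + 1) ^ (-k)) * (∑ i ∈ A, v (i : ℕ)) * ∑ i ∈ B, v (i : ℕ) := by
          gcongr
          exact hcle r
      _ = _ := by
          rw [hD]
          ring
  have hcov : ∀ i j r : ℕ, i + r < j →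
      |cov[ξ i, ξ j; P]| ≤ D * ((r : ℝ) + 1) ^ (-k) * v (i : ℕ) * v (j : ℕ) := by
    intro i j r hij
    refine (h.abs_cov_sum_le hz2 hv (hc r) T a hij).trans ?_
    have h1 := hv i
    have h2 := hv j
    have h3 : (∑ t ∈ T, |a t|) ^ 2 * (T.card : ℝ) ^ 2 * (Cκ * ((r : ℝ) + 1) ^ (-k)) ≤
        D * ((r : ℝ) + 1) ^ (-k) := by
      have : 0 ≤ (∑ t ∈ T, |a t|) ^ 2 * (T.card : ℝ) ^ 2 * (Cκ * ((r : ℝ) + 1) ^ (-k)) := by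
        positivity
      rw [hD]
      linarith
    calc _ ≤ (∑ t ∈ T, |a t|) ^ 2 * (T.card : ℝ) ^ 2 * (Cκ * ((r : ℝ) + 1) ^ (-k)) * v i * v j := by
          gcongr
          exact hcle r
      _ ≤ _ := by gcongr
  obtain ⟨Kv, hKv, hgv⟩ := hgv
  obtain ⟨Kp, hKp, hgp⟩ := hgp
  choose Km hKm hgm using hgm
  set C₁ := (T.card : ℝ) ^ (1 + δ) * ∑ t ∈ T, |a t| ^ (2 + δ) * Km t with hC₁
  have hC₁0 : 0 ≤ C₁ := mul_nonneg (by positivity)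
    (Finset.sum_nonneg fun t _ => mul_nonneg (by positivity) (hKm t))
  have hmom : ∀ N : ℕ, ∑ i ∈ Finset.Icc 1 N, ∫ ω, |ξ i ω| ^ (2 + δ) ∂P ≤
      C₁ * (N : ℝ) ^ (1 + ε) := by
    intro N
    refine (Finset.sum_le_sum fun i _ => (hξδ i).2).trans ?_
    rw [← Finset.mul_sum, Finset.sum_comm, hC₁, mul_assoc]
    gcongr
    rw [Finset.sum_mul]
    refine Finset.sum_le_sum fun t _ => ?_
    rw [← Finset.mul_sum, mul_assoc]
    gcongr
    exact hgm t N
  -- On the diagonal weak dependence says nothing; `x² ≤ 1 + |x|^{2 + δ}` reduces the variances to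
  -- the moments.
  have hdiag : ∀ i, |cov[ξ i, ξ i; P]| ≤ 1 + ∫ ω, |ξ i ω| ^ (2 + δ) ∂P := by
    intro i
    rw [covariance_self (hξ2 i).aestronglyMeasurable.aemeasurable,
      abs_of_nonneg (variance_nonneg _ _),
      variance_of_integral_eq_zero (hξ2 i).aestronglyMeasurable.aemeasurable (hξ0 i)]
    calc ∫ ω, ξ i ω ^ 2 ∂P ≤ ∫ ω, (1 + |ξ i ω| ^ (2 + δ)) ∂P := by
          refine integral_mono (hξ2 i).integrable_sq ((integrable_const _).add (hξδ i).1)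
            fun ω => ?_
          dsimp only
          have h0 : 0 ≤ |ξ i ω| ^ (2 + δ) := by positivity
          rcases le_or_gt |ξ i ω| 1 with h1 | h1
          · have : ξ i ω ^ 2 ≤ 1 := by
              rw [← sq_abs]
              exact pow_le_one₀ (abs_nonneg _) h1
            linarith
          · have : ξ i ω ^ 2 ≤ |ξ i ω| ^ (2 + δ) := by
              rw [← sq_abs, ← Real.rpow_two]
              exact Real.rpow_le_rpow_of_exponent_le h1.le (by linarith)
            linarith
      _ = _ := by
          rw [integral_add (integrable_const _) (hξδ i).1]
          simp
  have hoff : ∀ N : ℕ, ∑ i ∈ Finset.Icc 1 N, ∑ j ∈ Finset.Icc 1 N with i < j,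
      |cov[ξ i, ξ j; P]| ≤ D * Kp * (N : ℝ) ^ (1 + ε) := by
    intro N
    rw [mul_assoc]
    refine le_trans ?_ (mul_le_mul_of_nonneg_left (hgp N) hD0)
    rw [Finset.mul_sum]
    refine Finset.sum_le_sum fun i _ => ?_
    rw [Finset.mul_sum]
    refine Finset.sum_le_sum fun j hj => ?_
    have hij := (Finset.mem_filter.1 hj).2
    -- The pair is separated by a gap of length `j - i - 1`.
    refine (hcov i j (j - i - 1) (by omega)).trans (le_of_eq ?_)
    have : (((j - i - 1 : ℕ) : ℝ) + 1) = ((j - i : ℕ) : ℝ) := by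
      have : j - i - 1 + 1 = j - i := by omega
      exact_mod_cast this
    rw [this]
    ring
  have hgc : ∀ N : ℕ, ∑ i ∈ Finset.Icc 1 N, ∑ j ∈ Finset.Icc 1 N, |cov[ξ i, ξ j; P]| ≤
      (1 + C₁ + 2 * (D * Kp)) * (N : ℝ) ^ (1 + ε) := by
    intro N
    have hN : (N : ℝ) ≤ (N : ℝ) ^ (1 + ε) := by
      rcases Nat.eq_zero_or_pos N with rfl | hN
      · simp [Real.zero_rpow (by linarith : 1 + ε ≠ 0)]
      · exact Real.self_le_rpow_of_one_le (by exact_mod_cast hN) (by linarith)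
    have hsplit : ∀ i ∈ Finset.Icc 1 N, ∑ j ∈ Finset.Icc 1 N, |cov[ξ i, ξ j; P]| =
        |cov[ξ i, ξ i; P]| + ∑ j ∈ Finset.Icc 1 N with i < j, |cov[ξ i, ξ j; P]| +
          ∑ j ∈ Finset.Icc 1 N with j < i, |cov[ξ i, ξ j; P]| := by
      intro i hi
      have e1 : |cov[ξ i, ξ i; P]| =
          ∑ j ∈ Finset.Icc 1 N, if i = j then |cov[ξ i, ξ j; P]| else 0 := by
        rw [Finset.sum_ite_eq, if_pos hi]
      rw [e1, Finset.sum_filter, Finset.sum_filter, ← Finset.sum_add_distrib,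
        ← Finset.sum_add_distrib]
      refine Finset.sum_congr rfl fun j _ => ?_
      rcases lt_trichotomy i j with hlt | rfl | hlt
      · simp [hlt, hlt.ne, hlt.not_gt]
      · simp
      · simp [hlt, hlt.ne', hlt.not_gt]
    have hsym : ∑ i ∈ Finset.Icc 1 N, ∑ j ∈ Finset.Icc 1 N with j < i, |cov[ξ i, ξ j; P]| =
        ∑ i ∈ Finset.Icc 1 N, ∑ j ∈ Finset.Icc 1 N with i < j, |cov[ξ i, ξ j; P]| := by
      simp only [Finset.sum_filter]
      rw [Finset.sum_comm]
      refine Finset.sum_congr rfl fun i _ => Finset.sum_congr rfl fun j _ => ?_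
      rw [covariance_comm]
    rw [Finset.sum_congr rfl hsplit, Finset.sum_add_distrib, Finset.sum_add_distrib, hsym]
    have hd : ∑ i ∈ Finset.Icc 1 N, |cov[ξ i, ξ i; P]| ≤ N + C₁ * (N : ℝ) ^ (1 + ε) := by
      refine (Finset.sum_le_sum fun i _ => hdiag i).trans ?_
      rw [Finset.sum_add_distrib]
      simpa using hmom N
    have := hoff N
    linarith
  have hC2 : 0 ≤ D * Kp := mul_nonneg hD0 hKp
  have hle : ∀ {x C : ℝ} (N : ℕ), C ≤ Kv + (1 + C₁ + 2 * (D * Kp)) → x ≤ C * (N : ℝ) ^ (1 + ε) →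
      x ≤ (Kv + (1 + C₁ + 2 * (D * Kp))) * (N : ℝ) ^ (1 + ε) := fun N hC hx =>
    hx.trans (mul_le_mul_of_nonneg_right hC (by positivity))
  simp_rw [hswap] at hvar ⊢
  exact tendsto_expI_of_decoupling hξ2 hξ0 hδ (fun i => (hξδ i).1) (w := fun i : ℕ => v i)
    (fun i => hv i) hD0 hk hfac hcov hε hβ0 hβ hβ'
    (C := Kv + (1 + C₁ + 2 * (D * Kp))) (fun N => hle N (by linarith) (hgv N))
    (fun N => hle N (by linarith) (hmom N)) (fun N => hle N (by linarith) (hgc N)) hvar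

end

end DoublyStochastic

/-! ### Convergence of the partial aggregations -/

namespace DoublyStochastic

/-- A nonincreasing null sequence of order `O(r^{-k})` is bounded by a multiple of
`(r + 1)^{-k}` for all `r`, including the finitely many indices not covered by the asymptotics. -/
lemma exists_le_rpow_of_isBigO {c : ℕ → ℝ} (hanti : Antitone c) (hlim : Tendsto c atTop (𝓝 0))
    {k : ℝ} (hk : 0 ≤ k) (hO : c =O[atTop] fun r : ℕ => (r : ℝ) ^ (-k)) :
    (∀ r, 0 ≤ c r) ∧ ∃ C, 0 ≤ C ∧ ∀ r : ℕ, c r ≤ C * ((r : ℝ) + 1) ^ (-k) := by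
  have h0 : ∀ r, 0 ≤ c r := fun r => hanti.le_of_tendsto hlim r
  refine ⟨h0, ?_⟩
  obtain ⟨K, hK, hb⟩ := hO.exists_nonneg
  obtain ⟨n, hn⟩ := eventually_atTop.1 hb.bound
  have hp : ∀ r : ℕ, 0 < ((r : ℝ) + 1) ^ (-k) := fun r => Real.rpow_pos_of_pos (by positivity) _
  refine ⟨K * 2 ^ k + c 0 * ((n : ℝ) + 2) ^ k, ?_, fun r => ?_⟩
  · have := h0 0
    positivity
  · rcases lt_or_ge r (n + 1) with h | h
    · have h1 : c r ≤ c 0 := hanti (Nat.zero_le r)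
      have h2 : 1 ≤ ((n : ℝ) + 2) ^ k * ((r : ℝ) + 1) ^ (-k) := by
        rw [Real.rpow_neg (by positivity), ← div_eq_mul_inv,
          one_le_div (Real.rpow_pos_of_pos (by positivity) _)]
        refine Real.rpow_le_rpow (by positivity) ?_ hk
        have : (r : ℝ) < n + 1 := by exact_mod_cast h
        linarith
      have h3 : 0 ≤ K * 2 ^ k * ((r : ℝ) + 1) ^ (-k) := by positivity
      have h4 := h0 0
      calc c r ≤ c 0 * 1 := by linarith
        _ ≤ c 0 * (((n : ℝ) + 2) ^ k * ((r : ℝ) + 1) ^ (-k)) := by gcongr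
        _ ≤ _ := by linarith
    · have hr0 : (0 : ℝ) < r := by
        have : 0 < r := by omega
        exact_mod_cast this
      have h1 : c r ≤ K * (r : ℝ) ^ (-k) := by
        have := hn r (by omega)
        rw [Real.norm_of_nonneg (h0 r), Real.norm_of_nonneg (by positivity)] at this
        exact this
      have h2 : (r : ℝ) ^ (-k) ≤ 2 ^ k * ((r : ℝ) + 1) ^ (-k) := by
        have h3 : (2 * (r : ℝ)) ^ (-k) ≤ ((r : ℝ) + 1) ^ (-k) := by
          refine Real.rpow_le_rpow_of_nonpos (by positivity) ?_ (by linarith)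
          have : (1 : ℝ) ≤ r := by
            have : 1 ≤ r := by omega
            exact_mod_cast this
          linarith
        rw [Real.mul_rpow (by norm_num) hr0.le] at h3
        calc (r : ℝ) ^ (-k) = 2 ^ k * (2 ^ (-k) * (r : ℝ) ^ (-k)) := by
              rw [← mul_assoc, ← Real.rpow_add (by norm_num)]
              simp
          _ ≤ _ := by gcongr
      have h4 : 0 ≤ c 0 * ((n : ℝ) + 2) ^ k * ((r : ℝ) + 1) ^ (-k) := by
        have := h0 0
        positivity
      calc c r ≤ K * (2 ^ k * ((r : ℝ) + 1) ^ (-k)) := h1.trans (by gcongr)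
        _ ≤ _ := by linarith

variable {s : ℕ} {Ω Ω' : Type*} [MeasurableSpace Ω] [MeasurableSpace Ω']
  {P : Measure Ω} {P' : Measure Ω'} {μ : Measure (EuclideanSpace ℝ (Fin s))}

namespace Model

lemma measurable_agg (M : Model s P P' μ) (N : ℕ) (t : ℤ) (ω : Ω) : Measurable (M.agg N t ω) :=
  (Finset.measurable_fun_sum _ fun _ _ => M.measurable_elem_right _ _ _).const_mul _

/-- The law of the process `X^N(Y)` given the environment. -/
noncomputable def aggLaw [IsProbabilityMeasure P'] (M : Model s P P' μ) (ω : Ω) (N : ℕ) :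
    ProbabilityMeasure (ℤ → ℝ) :=
  ⟨P'.map fun ω' t => M.agg N t ω ω',
    Measure.isProbabilityMeasure_map
      (measurable_pi_lambda _ fun t => M.measurable_agg N t ω).aemeasurable⟩

lemma finCharFun_aggLaw [IsProbabilityMeasure P'] (M : Model s P P' μ) (ω : Ω) (N : ℕ)
    (T : Finset ℤ) (a : ℤ → ℝ) :
    finCharFun (M.aggLaw ω N : Measure (ℤ → ℝ)) T a =
      expI P' fun ω' => ∑ t ∈ T, a t * M.agg N t ω ω' := by
  have hc : Continuous fun x : ℤ → ℝ => Complex.exp ((∑ t ∈ T, a t * x t : ℝ) * Complex.I) := by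
    fun_prop
  rw [finCharFun, aggLaw, ProbabilityMeasure.coe_mk, integral_map
    (measurable_pi_lambda _ fun t => M.measurable_agg N t ω).aemeasurable
    hc.measurable.aestronglyMeasurable, expI]

/-- In almost every environment, the laws of the aggregates are tight and their
finite-dimensional characteristic functions converge to the Gaussian ones. -/
lemma ae_tight_and_tendsto [IsProbabilityMeasure P] [IsProbabilityMeasure P']
    (M : Model s P P' μ) (hstat : M.IsStationary) (hcent : M.IsCentered)
    {V : EuclideanSpace ℝ (Fin s) → ℝ} {κ : Ω → ℕ → ℝ} (hdep : M.IsKappaWeaklyDependent V κ)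
    {δ : ℝ} (hδ : 0 < δ)
    (hK2 : ∀ i t, Integrable (fun p : Ω × Ω' => |M.elem i t p.1 p.2| ^ (2 + δ)) (P.prod P'))
    {Γ : ℤ → ℝ}
    (hK4 : ∀ t τ, ∀ᵐ ω ∂P, Tendsto (fun N : ℕ => M.aggCov N t τ ω) atTop (𝓝 (Γ τ)))
    (hK5 : Integrable V μ) {k : ℝ} (hk : 2 + 2 / δ < k)
    (hrate : ∀ᵐ ω ∂P, (κ ω) =O[atTop] (fun r : ℕ => (r : ℝ) ^ (-k))) :
    ∀ᵐ ω ∂P, (∀ t τ, Tendsto (fun N : ℕ => M.aggCov N t τ ω) atTop (𝓝 (Γ τ))) ∧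
      IsTightMeasureSet {(M.aggLaw ω N : Measure (ℤ → ℝ)) | N} ∧
      ∀ T a, 0 ≤ ∑ t ∈ T, ∑ u ∈ T, a t * a u * Γ (u - t) ∧
        Tendsto (fun N => finCharFun (M.aggLaw ω N : Measure (ℤ → ℝ)) T a) atTop
          (𝓝 (Complex.exp (-((∑ t ∈ T, ∑ u ∈ T, a t * a u * Γ (u - t)) / 2 : ℝ)))) := by
  obtain ⟨hVm, hV0, hVb, hdep⟩ := hdep
  have hk0 : 0 < k := lt_trans (by positivity) hk
  have hk1 : 1 < k := by
    have : 0 < 2 / δ := by positivity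
    linarith
  -- The exponent `β` of the gap length lies strictly between `1 / k` and `θ`, the largest
  -- exponent of the block length allowed by Lyapunov's condition.
  set θ := δ / (2 * (1 + δ)) with hθ
  have hθδ : (1 + δ) * θ = δ / 2 := by
    rw [hθ]
    field_simp
  have hkθ : 1 / k < θ := by
    rw [hθ, div_lt_div_iff₀ hk0 (by positivity)]
    have : (2 + 2 / δ) * δ < k * δ := by gcongr
    have e : (2 + 2 / δ) * δ = 2 * δ + 2 := by field_simp
    linarith
  set β := (1 / k + θ) / 2 with hβ
  have hβ1 : 1 < k * β := by
    have : k * (1 / k) < k * β := by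
      gcongr
      rw [hβ]
      linarith
    rwa [mul_one_div_cancel hk0.ne'] at this
  have hβθ : β < θ := by
    rw [hβ]
    linarith
  have hβ0 : 0 ≤ β := by
    have : 0 < 1 / k := by positivity
    rw [hβ]
    linarith
  set ε := min ((k * β - 1) / 3) ((θ - β) / 4) with hε
  have hε0 : 0 < ε := lt_min (by linarith) (by linarith)
  have hε1 : ε ≤ (k * β - 1) / 3 := min_le_left _ _
  have hε2 : ε ≤ (θ - β) / 4 := min_le_right _ _
  have hβε : 1 + 2 * ε < k * β := by linarith
  have hβε' : (1 + δ) * (β + 2 * ε) + ε < δ / 2 := by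
    rw [← hθδ]
    nlinarith
  have hK4' : ∀ᵐ ω ∂P, ∀ t τ, Tendsto (fun N : ℕ => M.aggCov N t τ ω) atTop (𝓝 (Γ τ)) := by
    simp_rw [ae_all_iff]
    exact hK4
  filter_upwards [hcent, hVb, hdep, hK4', hrate, M.ae_moment_growth hstat hK2 hε0,
    M.ae_control_growth hVm hV0 hK5 hε0, M.ae_pair_growth hVm hV0 hK5 hk1 hε0]
    with ω hcent hVb hdep hK4 hrate hmom hctl hpair
  obtain ⟨hanti, hlim, hdep⟩ := hdep
  have hz := fun i t => M.measurable_elem_right i t ω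
  have hz2 : ∀ i t, MemLp (M.elem i t ω) 2 P' := fun i t => by
    rw [memLp_two_iff_integrable_sq (hz i t).aestronglyMeasurable]
    refine ⟨((hz i t).pow_const 2).aestronglyMeasurable, ?_⟩
    rw [hasFiniteIntegral_iff_ofReal (Eventually.of_forall fun _ => sq_nonneg _)]
    exact (hVb i t).trans_lt ENNReal.ofReal_lt_top
  obtain ⟨hc0, C, hC, hcC⟩ := exists_le_rpow_of_isBigO hanti hlim hk0.le hrate
  have hq : IsQuenchedDependent P' (fun i t => M.elem i t ω) (fun i => V (M.y i ω)) (κ ω) := hdep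
  have hagg : ∀ N t, MemLp (M.agg N t ω) 2 P' := fun N t =>
    (memLp_finsetSum (Finset.Icc 1 N) fun (i : ℕ) _ => hz2 i t).const_mul _
  have hmean : ∀ N t, ∫ ω', M.agg N t ω ω' ∂P' = 0 := fun N t => by
    simp only [agg]
    rw [integral_const_mul, integral_finsetSum _ fun (i : ℕ) _ => (hz2 i t).integrable one_le_two]
    simp [hcent]
  refine ⟨hK4, ?_, fun T a => ?_⟩
  · choose B hB using fun t => (hK4 t 0).bddAbove_range
    refine isTightMeasureSet_of_lintegral_sq_le (fun t => (B t).toNNReal) ?_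
    rintro _ ⟨N, rfl⟩ t
    have hm : Measurable fun x : ℤ → ℝ => ENNReal.ofReal (x t ^ 2) :=
      ((measurable_pi_apply t).pow_const 2).ennreal_ofReal
    rw [aggLaw, ProbabilityMeasure.coe_mk, lintegral_map hm
      (measurable_pi_lambda _ fun t => M.measurable_agg N t ω),
      ← ofReal_integral_eq_lintegral_ofReal (hagg N t).integrable_sq
        (Eventually.of_forall fun _ => sq_nonneg _)]
    refine ENNReal.ofReal_le_ofReal ?_
    have h1 : M.aggCov N t 0 ω ≤ B t := hB t ⟨N, rfl⟩
    rwa [aggCov, add_zero, covariance_self (M.measurable_agg N t ω).aemeasurable,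
      variance_of_integral_eq_zero (M.measurable_agg N t ω).aemeasurable (hmean N t)] at h1
  · have key := hq.tendsto_expI hz hz2 hcent (fun i => hV0 _) hδ hk0.le hmom.1 hc0 hC hcC hε0 hβ0
      hβε hβε' hmom.2 hctl hpair hK4 T a
    refine ⟨ge_of_tendsto' key.1 fun N => variance_nonneg _ _, ?_⟩
    simp_rw [finCharFun_aggLaw]
    exact key.2

end Model

end DoublyStochastic

theorem mainTheorem2 {s : ℕ} {Ω Ω' : Type*} [MeasurableSpace Ω] [MeasurableSpace Ω']
    (P : Measure Ω) (P' : Measure Ω') [IsProbabilityMeasure P] [IsProbabilityMeasure P']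
    (μ : Measure (EuclideanSpace ℝ (Fin s)))
    (M : DoublyStochastic.Model s P P' μ)
    (hstat : M.IsStationary) (hcent : M.IsCentered)
    (V : EuclideanSpace ℝ (Fin s) → ℝ) (κ : Ω → ℕ → ℝ)
    (hdep : M.IsKappaWeaklyDependent V κ)
    (δ : ℝ) (hδ : 0 < δ)
    (hK2 : ∀ i t, Integrable (fun p : Ω × Ω' => |M.elem i t p.1 p.2| ^ (2 + δ)) (P.prod P'))
    (Γ : ℤ → ℝ)
    (hK4 : ∀ t τ, ∀ᵐ ω ∂P, Tendsto (fun N : ℕ => M.aggCov N t τ ω) atTop (𝓝 (Γ τ)))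
    (hK5 : Integrable V μ)
    (k : ℝ) (hk : 2 + 2 / δ < k)
    (hrate : ∀ᵐ ω ∂P, (κ ω) =O[atTop] (fun r : ℕ => (r : ℝ) ^ (-k))) :
    ∃ (G : Measure (ℤ → ℝ)) (_ : IsProbabilityMeasure G),
      DoublyStochastic.IsCenteredGaussianLaw G Γ ∧
      ∀ᵐ ω ∂P, TendstoInDistribution
        (fun (N : ℕ) (ω' : Ω') (t : ℤ) => M.agg N t ω ω') atTop
        (fun x : ℤ → ℝ => x) (fun _ => P') G := by
  have hae := M.ae_tight_and_tendsto hstat hcent hdep hδ hK2 hK4 hK5 hk hrate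
  -- The limit law is constructed in one good environment, as a limit point given by tightness.
  obtain ⟨ω₀, hcov, htight, hlim⟩ := hae.exists
  obtain ⟨G, hG⟩ := DoublyStochastic.exists_finCharFun_eq_of_tight htight fun T a => (hlim T a).2
  have hΓ : ∀ τ, Γ (-τ) = Γ τ := fun τ => by
    refine tendsto_nhds_unique (hcov τ (-τ)) ((hcov 0 τ).congr fun N => ?_)
    rw [DoublyStochastic.Model.aggCov, DoublyStochastic.Model.aggCov, covariance_comm, zero_add,
      add_neg_cancel]
  refine ⟨G, inferInstance, DoublyStochastic.isCenteredGaussianLaw_of_finCharFun hΓ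
    (fun T a => (hlim T a).1) fun T a => ?_, ?_⟩
  · rw [hG]
    push_cast
    rfl
  · filter_upwards [hae] with ω hω
    refine ⟨fun N => (measurable_pi_lambda _ fun t => M.measurable_agg N t ω).aemeasurable,
      aemeasurable_id, ?_⟩
    have := DoublyStochastic.tendsto_of_tight_of_finCharFun (G := G) hω.2.1 fun T a => by
      rw [hG]
      exact (hω.2.2 T a).2
    convert! this using 2
    exact congrArg 𝓝 (Subtype.ext Measure.map_id)
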